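/- Fix $T>0$ and positive parameters $c,\lambda,\mu$ with $\mu<2\lambda$ and $cT>1$. Put $\nu=cT-\tfrac12$, $\lambda_\pm=\tfrac{\lambda}{\mu}\pm\tfrac12$, $a=\left(1+\tfrac{\mu}{2\lambda}\right)^{cT}$, $b=\left(1-\tfrac{\mu}{2\lambda}\right)^{cT}$. For $v>0$ let $$f_v(x)=\tfrac{a}{a+b}f_-(x)+\tfrac{b}{a+b}f_+(x),\qquad f_\pm(x)=\gamma_\pm\left|\tfrac{x}{\alpha}\right|^{\nu}e^{\beta_\pm x}K_{\nu}(\alpha|x|),$$ where $K_\nu$ is the modified Bessel function of the second kind, the value of $f_\pm$ at $x=0$ is the one given by continuity, and $$\alpha=\sqrt{\tfrac{\mu^2}{v^4}+\tfrac{2\lambda}{v^2}+\tfrac14},\qquad \beta_\pm=\pm\tfrac{\mu}{v^2}-\tfrac12,\qquad \gamma_\pm=\sqrt{\tfrac{2}{\pi}}\,\tfrac{1}{\Gamma(cT)}\left(\tfrac{\lambda\pm\mu/2}{v^2}\right)^{cT}.$$ For $v=0$ let $$f_0(x)=\tfrac{a}{a+b}\tfrac{\lambda_-^{cT}}{\Gamma(cT)}(-x)^{cT-1}e^{\lambda_-x}\mathbf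 1_{(-\infty,0)}(x)+\tfrac{b}{a+b}\tfrac{\lambda_+^{cT}}{\Gamma(cT)}x^{cT-1}e^{-\lambda_+x}\mathbf 1_{(0,\infty)}(x).$$ For an initial price $S_0>0$ let $C_v(K)=\int_K^\infty(s-K)\,\tfrac1s f_v(\log(s/S_0))\,ds$, and let the implied volatility $\sigma_v(K)$, $K>0$, be the unique $\sigma>0$ with $C_v(K)=C_{BS}(K,\sigma)$, where $C_{BS}(K,\sigma)$ is the Black--Scholes call price with spot $S_0$, maturity $T$, volatility $\sigma$ and zero interest rate. Let $\varphi_s(x)=\frac{1}{\sqrt{2\pi}\,s}\exp\left(-\tfrac12\left(\tfrac xs+\tfrac s2\right)^2\right)$. Then there is $v_*>0$, depending only on $c,\lambda,\mu,T$, such that for all $v\in[0,v_*)$ the function $f_v$ is a continuous probability density with $\int_{-\infty}^\infty e^xf_v(x)\,dx=1$ and (a) (geometric symmetry) $e^{x/2}f_v(x)=e^{-x/2}f_v(-x)$ for all $x\in\mathbb R$; (b) (semi-heavy tails) $\sup\{r\in\mathbb R:\int_{-\infty}^\infty e^{rx}f_v(x)\,dx<\infty\}<\infty$; and, for every $S_0>0$,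 the implied volatility $\sigma_v(K)$ exists for all $K>0$ and (c) (dip at zero) $f_v(0)<\varphi_{\sigma_v(S_0)\sqrt T}(0)$, and also $f_v(0)<\varphi_{\sigma_v(S_0)}(0)$. Moreover, for all $v\in[0,v_*)$ and $S_0>0$ the smile $K\mapsto\sigma_v(K)$ is (W+)-shaped: there is $\sigma_*\in(0,\infty)$ such that $K\mapsto\sigma_v(K)-\sigma_*$ on $(0,\infty)$ has exactly $d$ strict sign changes for some even number $d\ge4$, and its sequence of signs starts and ends with $+$. -/

import Mathlib

namespace WSmile

noncomputable section

open MeasureTheory ProbabilityTheory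

/-- The call-price function `C(K) = ∫_K^∞ (s - K) g(s) ds` belonging to the log-price density `f`,
where `g(s) = f(log(s/S₀)) / s` is the density of the price `S_T = S₀ exp(X_T)`. -/
def callPrice (f : ℝ → ℝ) (S₀ K : ℝ) : ℝ :=
  ∫ s in Set.Ioi K, (s - K) * (f (Real.log (s / S₀)) / s)

/-- The standard normal distribution function `Φ`. -/
def stdNormalCDF (x : ℝ) : ℝ := cdf (gaussianReal 0 1) x

/-- The Black-Scholes price (zero interest rate) of a call with strike `K`, spot `S₀`,
time-to-maturity `T` and volatility `σ`. -/
def bsCall (S₀ T K σ : ℝ) : ℝ :=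
  S₀ * stdNormalCDF ((Real.log (S₀ / K) + σ ^ 2 * T / 2) / (σ * √T))
    - K * stdNormalCDF ((Real.log (S₀ / K) - σ ^ 2 * T / 2) / (σ * √T))

/-- `σ` is the implied volatility smile of the log-price density `f`: for every strike `K > 0`,
`σ K` is the unique positive solution of `C(K) = C_BS(K, σ K)`.
The values of `σ` at `K ≤ 0` play no role. -/
def IsImpliedVolatility (f : ℝ → ℝ) (S₀ T : ℝ) (σ : ℝ → ℝ) : Prop :=
  ∀ K : ℝ, 0 < K →
    0 < σ K ∧ callPrice f S₀ K = bsCall S₀ T K (σ K) ∧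
      ∀ s : ℝ, 0 < s → callPrice f S₀ K = bsCall S₀ T K s → s = σ K

/-- The normal density `φ_σ` with variance `σ²` and mean `-σ²/2`. -/
def bsDensity (σ x : ℝ) : ℝ :=
  1 / (√(2 * Real.pi) * σ) * Real.exp (-(1 / 2) * (x / σ + σ / 2) ^ 2)

/-- `f` is a continuous probability density with the risk-neutrality condition `∫ eˣ f(x) dx = 1`.
(The two Bochner integrals are nonzero, hence the integrands are integrable.) -/
def IsRiskNeutralDensity (f : ℝ → ℝ) : Prop :=
  Continuous f ∧ (∀ x, 0 ≤ f x) ∧ ∫ x, f x = 1 ∧ ∫ x, Real.exp x * f x = 1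

/-- Geometric symmetry: `e^{x/2} f(x) = e^{-x/2} f(-x)` for all `x`. -/
def GeometricSymmetry (f : ℝ → ℝ) : Prop :=
  ∀ x : ℝ, Real.exp (x / 2) * f x = Real.exp (-x / 2) * f (-x)

/-- Semi-heavy tails: `sup {r : ∫ e^{rx} f(x) dx < ∞} < ∞` (for nonnegative measurable `f`). -/
def SemiHeavyTails (f : ℝ → ℝ) : Prop :=
  BddAbove {r : ℝ | Integrable (fun x : ℝ => Real.exp (r * x) * f x)}

/-- Dip at zero with respect to the normal density `φ_s`: `f(0) < φ_s(0)`. -/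
def DipAtZero (f : ℝ → ℝ) (s : ℝ) : Prop :=
  f 0 < bsDensity s 0

/-- `k` is an increasing sequence of points of `(0, ∞)` along which `h` is nonzero and changes its
sign at every step; with `n + 1` points it exhibits `n` (strong) sign changes of `h`. -/
def AlternatesAlong (h : ℝ → ℝ) {n : ℕ} (k : Fin (n + 1) → ℝ) : Prop :=
  StrictMono k ∧ (∀ i, 0 < k i) ∧ (∀ i, h (k i) ≠ 0) ∧
    ∀ i : Fin n, h (k i.castSucc) * h (k i.succ) < 0

/-- `K ↦ σ K` (on `(0, ∞)`) is (W+)-shaped: for some level `s > 0` the function `K ↦ σ K - s` has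
exactly `d` strong sign changes, with `d ≥ 4` even, and its sign sequence starts and ends
with `+`. -/
def IsWPlusShaped (σ : ℝ → ℝ) : Prop :=
  ∃ s : ℝ, 0 < s ∧ ∃ d : ℕ, Even d ∧ 4 ≤ d ∧
    (∃ k : Fin (d + 1) → ℝ, AlternatesAlong (fun K => σ K - s) k ∧
      0 < σ (k 0) - s ∧ 0 < σ (k (Fin.last d)) - s) ∧
    ¬ ∃ k : Fin (d + 1 + 1) → ℝ, AlternatesAlong (fun K => σ K - s) k

/-- The modified Bessel function of the second kind,
`K_ν(z) = ½ ∫_0^∞ t^{ν-1} exp(-(z/2)(t + 1/t)) dt` for `z > 0`; the substitution `t = e^u` gives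
`∫_0^∞ e^{-z cosh u} cosh(ν u) du`. -/
def besselK (ν z : ℝ) : ℝ :=
  1 / 2 * ∫ t in Set.Ioi (0 : ℝ), t ^ (ν - 1) * Real.exp (-(z / 2) * (t + 1 / t))

/-- The parameter `α = √(μ²/v⁴ + 2λ/v² + 1/4)`. -/
def vgAlpha (lam μ v : ℝ) : ℝ :=
  √(μ ^ 2 / v ^ 4 + 2 * lam / v ^ 2 + 1 / 4)

/-- The parameters `β_± = ±μ/v² - 1/2`, with `ε = ±1`. -/
def vgBeta (μ v ε : ℝ) : ℝ := ε * (μ / v ^ 2) - 1 / 2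

/-- The normalizing constants `γ_± = √(2/π) Γ(cT)⁻¹ ((λ ± μ/2)/v²)^{cT}`, with `ε = ±1`. -/
def vgGamma (c lam μ T v ε : ℝ) : ℝ :=
  √(2 / Real.pi) * (1 / Real.Gamma (c * T)) * ((lam + ε * (μ / 2)) / v ^ 2) ^ (c * T)

/-- The variance-gamma density `f_±(x) = γ_± |x/α|^ν e^{β_± x} K_ν(α|x|)` with `ν = cT - 1/2`,
for `v > 0` and `ε = ±1`. At `x = 0` it has the value of its continuous extension,
`γ_± 2^{ν-1} Γ(ν) α^{-2ν}`, because `z^ν K_ν(z) → 2^{ν-1} Γ(ν)` as `z ↓ 0` when `ν > 0`. -/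
def vgDensity (c lam μ T v ε x : ℝ) : ℝ :=
  if x = 0 then
    vgGamma c lam μ T v ε * (2 ^ (c * T - 1 / 2 - 1) * Real.Gamma (c * T - 1 / 2)) *
      vgAlpha lam μ v ^ (-(2 * (c * T - 1 / 2)))
  else
    vgGamma c lam μ T v ε * |x / vgAlpha lam μ v| ^ (c * T - 1 / 2) *
      Real.exp (vgBeta μ v ε * x) * besselK (c * T - 1 / 2) (vgAlpha lam μ v * |x|)

/-- The constant `a = (1 + μ/(2λ))^{cT}`. -/
def mixA (c lam μ T : ℝ) : ℝ := (1 + μ / (2 * lam)) ^ (c * T)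

/-- The constant `b = (1 - μ/(2λ))^{cT}`. -/
def mixB (c lam μ T : ℝ) : ℝ := (1 - μ / (2 * lam)) ^ (c * T)

/-- The asymmetric double gamma density `f_0`, with `λ_± = λ/μ ± 1/2`. -/
def doubleGammaDensity (c lam μ T x : ℝ) : ℝ :=
  mixA c lam μ T / (mixA c lam μ T + mixB c lam μ T) *
      (if x < 0 then
        (lam / μ - 1 / 2) ^ (c * T) / Real.Gamma (c * T) * (-x) ^ (c * T - 1) *
          Real.exp ((lam / μ - 1 / 2) * x)
      else 0)
    + mixB c lam μ T / (mixA c lam μ T + mixB c lam μ T) *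
      (if 0 < x then
        (lam / μ + 1 / 2) ^ (c * T) / Real.Gamma (c * T) * x ^ (c * T - 1) *
          Real.exp (-(lam / μ + 1 / 2) * x)
      else 0)

/-- The density `f_v` of the log-price in the variance-gamma mixture model: for `v > 0` it is
`a/(a+b) f_- + b/(a+b) f_+`, and for `v = 0` it is the double gamma density. -/
def mixDensity (c lam μ T v x : ℝ) : ℝ :=
  if v = 0 then doubleGammaDensity c lam μ T x
  else
    mixA c lam μ T / (mixA c lam μ T + mixB c lam μ T) * vgDensity c lam μ T v (-1) x
      + mixB c lam μ T / (mixA c lam μ T + mixB c lam μ T) * vgDensity c lam μ T v 1 x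

end

end WSmile

/-!
For `v > 0` the density is written as `f_v(x) = p (e^{β₋x} + e^{β₊x}) J(x)` with the even function
`J(x) = ∫_0^∞ u^{ν-1} e^{-α²u/2 - x²/(2u)} du` (`mixDensity_eq`): the Bessel function becomes a gamma
mixture of Gaussians. Fubini gives the total mass (`integral_exp_mul_mixtureIntegral`), and since `J`
is the moment generating function of `-1/u` at `x²/2`, it is real analytic on `(0, ∞)`. For `v = 0`
the corresponding facts are elementary (`isSmileDensity_doubleGammaDensity`).

Geometric symmetry means `eˣ f(x) = f(-x)`, so that with the survival function `G(k) = ∫_k^∞ f` the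
normalized call price with log-strike `k` is `1 - G(-k) - e^k G(k)` (`integral_payoff`). The
Black–Scholes price is of the same form with a normal density `φ_w`, where `w = σ√T`. Because vega is
positive, the implied volatility exists, and it exceeds a level `w/√T` exactly where the difference
`D` of the two prices is positive. One has `D(-k) = e^{-k} D(k)`, `D' = -e^k (G_f - G_φ)` and
`(G_f - G_φ)' = φ_w - f`.

If `f(0) < φ_{w₀}(0)` for the at-the-money total volatility `w₀`, then `D(0) = 0` forces
`G_f(0) = G_φ(0)`, hence `D < 0` slightly off the money (`exists_callGap_neg`). For `w` slightly below
`w₀` this strict inequality persists while `D(0) > 0`; in both tails `D > 0` because `f` decays only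
exponentially. This is the pattern `+ - + - +`. The number of sign changes is finite, as an
accumulation point of zeros of `D` would by Rolle's theorem be one of `f - φ_w`, which is analytic on
`(0, ∞)` and not identically zero there (`finite_zeros_callGap`). A sequence with the maximal number
of sign changes then starts and ends with `+` (`exists_even_max_alternation`).

The dip at zero holds for small `v` since `f_v(0) = O(v^{2(cT-1)})` (`exists_mixDensity_zero_le`),
whereas the at-the-money volatility is bounded: the component `f₊` leaves at least the mass
`b / (2(a+b))` to the right of `0` (`le_survival_mixDensity`).
-/

namespace WSmile

noncomputable section

open MeasureTheory ProbabilityTheory Set Filter Topology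

/-! ### Densities with geometric symmetry -/

/-- A continuous probability density on `ℝ` which satisfies the geometric symmetry
`e^{x/2} f(x) = e^{-x/2} f(-x)`. Risk neutrality is then automatic. -/
structure IsSymmetricDensity (f : ℝ → ℝ) : Prop where
  continuous : Continuous f
  nonneg : ∀ x, 0 ≤ f x
  integral_eq_one : ∫ x, f x = 1
  symm : GeometricSymmetry f

/-- The survival function `k ↦ ∫_k^∞ f`. -/
def survival (f : ℝ → ℝ) (k : ℝ) : ℝ := ∫ x in Ioi k, f x

/-- The symmetric form `1 - G(-k) - e^k G(k)` of a normalized call price (spot `1`, log-strike `k`)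
in terms of a survival function `G`. -/
def symmCall (G : ℝ → ℝ) (k : ℝ) : ℝ := 1 - G (-k) - Real.exp k * G k

lemma symmCall_neg (G : ℝ → ℝ) (k : ℝ) :
    symmCall G (-k) = 1 - Real.exp (-k) + Real.exp (-k) * symmCall G k := by
  have h : Real.exp (-k) * Real.exp k = 1 := by rw [← Real.exp_add]; simp
  simp only [symmCall, neg_neg]
  linear_combination G k * h

lemma symmCall_zero (G : ℝ → ℝ) : symmCall G 0 = 1 - 2 * G 0 := by
  simp [symmCall]; ring

lemma setIntegral_Ioi_pos {F : ℝ → ℝ} {k : ℝ} (hi : IntegrableOn F (Ioi k))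
    (hpos : ∀ x, k < x → 0 < F x) : 0 < ∫ x in Ioi k, F x := by
  rw [setIntegral_pos_iff_support_of_nonneg_ae _ hi]
  · have : Function.support F ∩ Ioi k = Ioi k := by
      ext x
      simp only [mem_inter_iff, Function.mem_support, mem_Ioi, and_iff_right_iff_imp]
      exact fun h => (hpos x h).ne'
    rw [this]
    simp
  · exact (ae_restrict_iff' measurableSet_Ioi).2 (Eventually.of_forall fun x hx => (hpos x hx).le)

lemma hasDerivAt_survival {f : ℝ → ℝ} (hf : Continuous f) (hi : Integrable f) (k : ℝ) :
    HasDerivAt (survival f) (-f k) k := by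
  have h : survival f = fun x => (∫ y in Ioi (0 : ℝ), f y) - ∫ y in (0 : ℝ)..x, f y := by
    funext x
    rw [← intervalIntegral.integral_Ioi_sub_Ioi' hi.integrableOn hi.integrableOn]
    simp [survival]
  rw [h]
  exact (intervalIntegral.integral_hasDerivAt_right (hf.intervalIntegrable _ _)
    hf.aestronglyMeasurable.stronglyMeasurableAtFilter hf.continuousAt).const_sub _

namespace IsSymmetricDensity

variable {f : ℝ → ℝ}

lemma integrable (hf : IsSymmetricDensity f) : Integrable f :=
  integrable_of_integral_eq_one hf.integral_eq_one

lemma exp_mul (hf : IsSymmetricDensity f) (x : ℝ) : Real.exp x * f x = f (-x) := by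
  have h := congrArg (fun y => Real.exp (x / 2) * y) (hf.symm x)
  simp only [← mul_assoc, ← Real.exp_add] at h
  rw [show x / 2 + x / 2 = x by ring, show x / 2 + -x / 2 = 0 by ring] at h
  simpa using h

lemma integrable_exp_mul (hf : IsSymmetricDensity f) : Integrable fun x => Real.exp x * f x := by
  simp only [hf.exp_mul]
  exact hf.integrable.comp_neg

lemma isRiskNeutralDensity (hf : IsSymmetricDensity f) : IsRiskNeutralDensity f := by
  refine ⟨hf.continuous, hf.nonneg, hf.integral_eq_one, ?_⟩
  simp only [hf.exp_mul]
  rw [integral_neg_eq_self f, hf.integral_eq_one]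

lemma integral_Iic (hf : IsSymmetricDensity f) (k : ℝ) :
    ∫ x in Iic k, f x = 1 - survival f k := by
  have h := integral_add_compl (measurableSet_Iic (a := k)) hf.integrable
  rw [compl_Iic, hf.integral_eq_one] at h
  simp only [survival]; linarith

lemma integral_Ioi_exp_mul (hf : IsSymmetricDensity f) (k : ℝ) :
    ∫ x in Ioi k, Real.exp x * f x = 1 - survival f (-k) := by
  simp only [hf.exp_mul]
  rw [integral_comp_neg_Ioi k f, hf.integral_Iic]

/-- Since `eˣ f(x) = f(-x)`, a call price is an expression in the survival function alone. -/
lemma integral_payoff (hf : IsSymmetricDensity f) (k : ℝ) :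
    ∫ x in Ioi k, (Real.exp x - Real.exp k) * f x = symmCall (survival f) k := by
  simp only [sub_mul]
  rw [integral_sub hf.integrable_exp_mul.integrableOn
    (hf.integrable.const_mul _).integrableOn, hf.integral_Ioi_exp_mul, integral_const_mul]
  rfl

lemma integrableOn_payoff (hf : IsSymmetricDensity f) (k : ℝ) :
    IntegrableOn (fun x => (Real.exp x - Real.exp k) * f x) (Ioi k) := by
  simp only [sub_mul]
  exact hf.integrable_exp_mul.integrableOn.sub (hf.integrable.const_mul _).integrableOn

lemma hasDerivAt_survival (hf : IsSymmetricDensity f) (k : ℝ) :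
    HasDerivAt (survival f) (-f k) k :=
  WSmile.hasDerivAt_survival hf.continuous hf.integrable k

lemma survival_pos (hf : IsSymmetricDensity f) {k : ℝ} (hpos : ∀ x, k < x → 0 < f x) :
    0 < survival f k := by
  exact setIntegral_Ioi_pos hf.integrable.integrableOn hpos

end IsSymmetricDensity

/-- The call price in terms of the log-price, by the substitution `s = S₀ eˣ`. -/
lemma callPrice_eq (f : ℝ → ℝ) {S₀ K : ℝ} (hS : 0 < S₀) (hK : 0 < K) :
    callPrice f S₀ K
      = S₀ * ∫ x in Ioi (Real.log (K / S₀)), (Real.exp x - Real.exp (Real.log (K / S₀))) * f x := by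
  have himg : (fun x => S₀ * Real.exp x) '' Ioi (Real.log (K / S₀)) = Ioi K := by
    ext s
    simp only [mem_image, mem_Ioi]
    constructor
    · rintro ⟨x, hx, rfl⟩
      rw [Real.log_lt_iff_lt_exp (by positivity), div_lt_iff₀ hS] at hx
      linarith
    · intro hs
      have hs0 : 0 < s := hK.trans hs
      refine ⟨Real.log (s / S₀), Real.log_lt_log (by positivity) (by gcongr), ?_⟩
      rw [Real.exp_log (by positivity)]
      field_simp
  have hcv := integral_image_eq_integral_abs_deriv_smul
    (f := fun x => S₀ * Real.exp x) (f' := fun x => S₀ * Real.exp x)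
    (measurableSet_Ioi (a := Real.log (K / S₀)))
    (fun x _ => ((Real.hasDerivAt_exp x).const_mul S₀).hasDerivWithinAt)
    (fun x _ y _ h => Real.exp_injective (mul_left_cancel₀ hS.ne' h))
    (fun s => (s - K) * (f (Real.log (s / S₀)) / s))
  rw [himg] at hcv
  rw [callPrice, hcv, ← integral_const_mul]
  refine setIntegral_congr_fun measurableSet_Ioi fun x _ => ?_
  have he := Real.exp_pos x
  simp only [smul_eq_mul]
  rw [abs_of_pos (by positivity), mul_div_cancel_left₀ _ hS.ne', Real.log_exp,
    Real.exp_log (by positivity)]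
  field_simp

lemma IsSymmetricDensity.callPrice_eq {f : ℝ → ℝ} (hf : IsSymmetricDensity f) {S₀ K : ℝ}
    (hS : 0 < S₀) (hK : 0 < K) :
    callPrice f S₀ K = S₀ * symmCall (survival f) (Real.log (K / S₀)) := by
  rw [WSmile.callPrice_eq f hS hK, hf.integral_payoff]

/-! ### The normal distribution and Black–Scholes prices -/

/-- The standard normal density. -/
def stdNormalPDF (x : ℝ) : ℝ := gaussianPDFReal 0 1 x

lemma stdNormalPDF_eq (x : ℝ) :
    stdNormalPDF x = (√(2 * Real.pi))⁻¹ * Real.exp (-x ^ 2 / 2) := by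
  simp [stdNormalPDF, gaussianPDFReal]

lemma stdNormalPDF_pos (x : ℝ) : 0 < stdNormalPDF x := by
  rw [stdNormalPDF_eq]; positivity

lemma stdNormalPDF_neg (x : ℝ) : stdNormalPDF (-x) = stdNormalPDF x := by
  simp [stdNormalPDF_eq]

lemma stdNormalPDF_le_one (x : ℝ) : stdNormalPDF x ≤ 1 := by
  rw [stdNormalPDF_eq]
  have h1 : 1 ≤ √(2 * Real.pi) := by
    rw [Real.one_le_sqrt]; linarith [Real.pi_gt_three]
  have h2 : Real.exp (-x ^ 2 / 2) ≤ 1 := by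
    rw [Real.exp_le_one_iff]; nlinarith [sq_nonneg x]
  exact mul_le_one₀ (inv_le_one_of_one_le₀ h1) (Real.exp_pos _).le h2

lemma continuous_stdNormalPDF : Continuous stdNormalPDF := by
  have : stdNormalPDF = fun x => (√(2 * Real.pi))⁻¹ * Real.exp (-x ^ 2 / 2) :=
    funext stdNormalPDF_eq
  rw [this]; fun_prop

lemma integrable_stdNormalPDF : Integrable stdNormalPDF := integrable_gaussianPDFReal 0 1

lemma integral_stdNormalPDF : ∫ x, stdNormalPDF x = 1 :=
  integral_gaussianPDFReal_eq_one 0 one_ne_zero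

lemma stdNormalCDF_eq_survival (x : ℝ) : stdNormalCDF x = survival stdNormalPDF (-x) := by
  rw [stdNormalCDF, cdf_eq_real, measureReal_def, gaussianReal_apply_eq_integral _ one_ne_zero,
    ENNReal.toReal_ofReal (integral_nonneg fun x => gaussianPDFReal_nonneg _ _ _), survival,
    show (∫ y in Iic x, gaussianPDFReal 0 1 y) = ∫ y in Iic x, stdNormalPDF (-y) from ?_,
    integral_comp_neg_Iic]
  simp only [stdNormalPDF_neg]; rfl

lemma hasDerivAt_stdNormalCDF (x : ℝ) : HasDerivAt stdNormalCDF (stdNormalPDF x) x := by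
  have h : stdNormalCDF = fun x => survival stdNormalPDF (-x) := funext stdNormalCDF_eq_survival
  rw [h]
  have := (hasDerivAt_survival continuous_stdNormalPDF integrable_stdNormalPDF (-x)).comp x
    (hasDerivAt_neg x)
  simpa [stdNormalPDF_neg, Function.comp_def] using this

lemma stdNormalCDF_neg (x : ℝ) : stdNormalCDF (-x) = 1 - stdNormalCDF x := by
  have h := integral_add_compl (measurableSet_Iic (a := -x)) integrable_stdNormalPDF
  rw [compl_Iic, integral_stdNormalPDF] at h
  have h2 : ∫ y in Iic (-x), stdNormalPDF y = ∫ y in Ioi x, stdNormalPDF y := by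
    rw [← integral_comp_neg_Ioi]; simp only [stdNormalPDF_neg]
  rw [stdNormalCDF_eq_survival, stdNormalCDF_eq_survival, neg_neg, survival, survival]
  linarith

lemma strictMono_stdNormalCDF : StrictMono stdNormalCDF :=
  strictMono_of_hasDerivAt_pos hasDerivAt_stdNormalCDF stdNormalPDF_pos

lemma tendsto_stdNormalCDF_atTop : Tendsto stdNormalCDF atTop (𝓝 1) := tendsto_cdf_atTop _

lemma tendsto_stdNormalCDF_atBot : Tendsto stdNormalCDF atBot (𝓝 0) := tendsto_cdf_atBot _

/-- `Φ` is Lipschitz with constant `1`, since its density is at most `1`. -/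
lemma stdNormalCDF_sub_le {x y : ℝ} (h : x ≤ y) : stdNormalCDF y - stdNormalCDF x ≤ y - x := by
  have hmono : Monotone fun t => t - stdNormalCDF t :=
    monotone_of_hasDerivAt_nonneg (f' := fun t => 1 - stdNormalPDF t)
      (fun t => (hasDerivAt_id t).sub (hasDerivAt_stdNormalCDF t))
      (fun t => by simpa using stdNormalPDF_le_one t)
  have := hmono h
  simp only at this; linarith

/-- The survival function of a normal variable with variance `w²` and mean `-w²/2`. -/
def bsSurvival (w k : ℝ) : ℝ := stdNormalCDF (-k / w - w / 2)

/-- The normalized Black–Scholes price with spot `1`, log-strike `k` and total volatility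
`w = σ √T`. -/
def bsPrice (k w : ℝ) : ℝ := symmCall (bsSurvival w) k

lemma bsPrice_eq (k w : ℝ) :
    bsPrice k w = stdNormalCDF (-k / w + w / 2) - Real.exp k * stdNormalCDF (-k / w - w / 2) := by
  rw [bsPrice, symmCall, bsSurvival, bsSurvival,
    show - -k / w - w / 2 = -(-k / w + w / 2) by ring, stdNormalCDF_neg]
  ring

lemma bsCall_eq {S₀ T K σ : ℝ} (hS : 0 < S₀) (hK : 0 < K) (hT : 0 < T) (hσ : 0 < σ) :
    bsCall S₀ T K σ = S₀ * bsPrice (Real.log (K / S₀)) (σ * √T) := by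
  have hsT : 0 < √T := Real.sqrt_pos.2 hT
  have hlog : Real.log (S₀ / K) = -Real.log (K / S₀) := by rw [← Real.log_inv, inv_div]
  have h1 : σ ^ 2 * T / 2 / (σ * √T) = σ * √T / 2 := by
    nth_rewrite 1 [← Real.sq_sqrt hT.le]; field_simp
  rw [bsCall, bsPrice_eq, Real.exp_log (by positivity), hlog, add_div, sub_div, h1]
  field_simp

/-- The relation `e^k φ(d₂) = φ(d₁)` between the two arguments of the Black–Scholes formula. -/
lemma stdNormalPDF_shift (k : ℝ) {w : ℝ} (hw : 0 < w) :
    Real.exp k * stdNormalPDF (-k / w - w / 2) = stdNormalPDF (-k / w + w / 2) := by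
  rw [stdNormalPDF_eq, stdNormalPDF_eq, mul_left_comm, ← Real.exp_add]
  congr 2
  field_simp
  ring

lemma hasDerivAt_bsPrice (k : ℝ) {w : ℝ} (hw : 0 < w) :
    HasDerivAt (bsPrice k) (stdNormalPDF (-k / w + w / 2)) w := by
  have h : bsPrice k = fun w =>
      stdNormalCDF (-k / w + w / 2) - Real.exp k * stdNormalCDF (-k / w - w / 2) :=
    funext (bsPrice_eq k)
  rw [h]
  have h1 : HasDerivAt (fun w => -k / w) (k / w ^ 2) w := by
    have := (hasDerivAt_inv hw.ne').const_mul (-k)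
    simpa [div_eq_mul_inv] using this
  have h2 : HasDerivAt (fun w : ℝ => w / 2) (1 / 2) w := (hasDerivAt_id w).div_const 2
  have := ((hasDerivAt_stdNormalCDF _).comp w (h1.add h2)).sub
    (((hasDerivAt_stdNormalCDF _).comp w (h1.sub h2)).const_mul (Real.exp k))
  refine this.congr_deriv ?_
  rw [← mul_assoc, Pi.sub_apply, Pi.add_apply, stdNormalPDF_shift k hw]
  ring

lemma continuousOn_bsPrice (k : ℝ) : ContinuousOn (bsPrice k) (Ioi 0) :=
  fun _ hw => (hasDerivAt_bsPrice k hw).continuousAt.continuousWithinAt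

/-- Positivity of vega: the Black–Scholes price is strictly increasing in the volatility. -/
lemma strictMonoOn_bsPrice (k : ℝ) : StrictMonoOn (bsPrice k) (Ioi 0) := by
  refine strictMonoOn_of_deriv_pos (convex_Ioi 0) (continuousOn_bsPrice k) fun w hw => ?_
  rw [interior_Ioi] at hw
  rw [(hasDerivAt_bsPrice k hw).deriv]
  exact stdNormalPDF_pos _

lemma bsPrice_le {k w : ℝ} (hk : 0 ≤ k) (hw : 0 < w) : bsPrice k w ≤ w := by
  rw [bsPrice_eq]
  have h1 : 1 ≤ Real.exp k := Real.one_le_exp hk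
  have h2 : 0 ≤ stdNormalCDF (-k / w - w / 2) := cdf_nonneg _ _
  have h3 := stdNormalCDF_sub_le (show -k / w - w / 2 ≤ -k / w + w / 2 by linarith)
  nlinarith

lemma tendsto_bsPrice_atTop (k : ℝ) : Tendsto (bsPrice k) atTop (𝓝 1) := by
  have h : bsPrice k = fun w =>
      stdNormalCDF (-k / w + w / 2) - Real.exp k * stdNormalCDF (-k / w - w / 2) :=
    funext (bsPrice_eq k)
  rw [h]
  have h1 : Tendsto (fun w : ℝ => -k / w) atTop (𝓝 0) := tendsto_const_nhds.div_atTop tendsto_id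
  have h2 : Tendsto (fun w : ℝ => w / 2) atTop atTop := tendsto_id.atTop_div_const two_pos
  have h3 := tendsto_stdNormalCDF_atTop.comp (h1.add_atTop h2)
  have h4 : Tendsto (fun w : ℝ => -k / w - w / 2) atTop atBot := by
    simpa only [sub_eq_add_neg, Function.comp_def] using h1.add_atBot (tendsto_neg_atTop_atBot.comp h2)
  have h5 := (tendsto_stdNormalCDF_atBot.comp h4).const_mul (Real.exp k)
  simpa using h3.sub h5

lemma bsDensity_eq_stdNormalPDF (w x : ℝ) :
    bsDensity w x = w⁻¹ * stdNormalPDF (x / w + w / 2) := by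
  rw [bsDensity, stdNormalPDF_eq, one_div, mul_inv, mul_comm (√(2 * Real.pi))⁻¹ w⁻¹, mul_assoc]
  congr 3
  ring

lemma survival_bsDensity {w : ℝ} (hw : 0 < w) (k : ℝ) :
    survival (bsDensity w) k = bsSurvival w k := by
  have h1 := integral_comp_mul_left_Ioi (fun y => stdNormalPDF (y + w / 2)) k (inv_pos.2 hw)
  have h2 : ∫ y in Ioi (w⁻¹ * k), stdNormalPDF (y + w / 2)
      = ∫ y in Ioi (w⁻¹ * k + w / 2), stdNormalPDF y := by
    simpa using (measurePreserving_add_right volume (w / 2)).setIntegral_preimage_emb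
      (measurableEmbedding_addRight _) stdNormalPDF (Ioi (w⁻¹ * k + w / 2))
  rw [survival, bsSurvival, stdNormalCDF_eq_survival, survival]
  simp only [bsDensity_eq_stdNormalPDF]
  rw [integral_const_mul]
  simp only [div_eq_inv_mul] at h1 h2 ⊢
  rw [h1, h2, smul_eq_mul, inv_inv, inv_mul_cancel_left₀ hw.ne']
  congr 3
  ring

lemma isSymmetricDensity_bsDensity {w : ℝ} (hw : 0 < w) : IsSymmetricDensity (bsDensity w) where
  continuous := by unfold bsDensity; fun_prop
  nonneg x := by unfold bsDensity; positivity
  integral_eq_one := by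
    simp only [bsDensity_eq_stdNormalPDF]
    rw [integral_const_mul, Measure.integral_comp_div (fun y => stdNormalPDF (y + w / 2)),
      integral_add_right_eq_self stdNormalPDF, abs_of_pos hw, integral_stdNormalPDF, smul_eq_mul,
      mul_one, inv_mul_cancel₀ hw.ne']
  symm x := by
    unfold bsDensity
    rw [mul_left_comm, mul_left_comm (Real.exp (-x / 2)), ← Real.exp_add, ← Real.exp_add]
    congr 2
    field_simp
    ring

lemma bsDensity_zero_eq (w : ℝ) :
    bsDensity w 0 = 1 / (√(2 * Real.pi) * w) * Real.exp (-(w ^ 2 / 8)) := by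
  rw [bsDensity]; congr 2; ring

lemma bsDensity_zero_antitone {w w' : ℝ} (hw : 0 < w) (h : w ≤ w') :
    bsDensity w' 0 ≤ bsDensity w 0 := by
  rw [bsDensity_zero_eq, bsDensity_zero_eq]
  have hw' : 0 < w' := hw.trans_le h
  gcongr

lemma bsDensity_zero_pos {w : ℝ} (hw : 0 < w) : 0 < bsDensity w 0 := by
  rw [bsDensity_zero_eq]; positivity

/-! ### Existence of the implied volatility -/

namespace IsSymmetricDensity

variable {f : ℝ → ℝ}

/-- Every normalized call price of a density which is positive away from `0` is attained by the
Black–Scholes formula at exactly one volatility; the geometric symmetry of both prices reduces the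
claim to strikes above the spot. -/
lemma exists_bsPrice_eq (hf : IsSymmetricDensity f) (hpos : ∀ x, x ≠ 0 → 0 < f x) (k : ℝ) :
    ∃ w, 0 < w ∧ symmCall (survival f) k = bsPrice k w := by
  have key : ∀ k, 0 ≤ k → ∃ w, 0 < w ∧ symmCall (survival f) k = bsPrice k w := by
    intro k hk
    have hF : 0 < survival f k := hf.survival_pos fun x hx => hpos x (hk.trans_lt hx).ne'
    have hF' : 0 ≤ survival f (-k) := setIntegral_nonneg measurableSet_Ioi fun x _ => hf.nonneg x
    have hlt : symmCall (survival f) k < 1 := by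
      have := mul_pos (Real.exp_pos k) hF
      simp only [symmCall]; linarith
    have hgt : 0 < symmCall (survival f) k := by
      rw [← hf.integral_payoff]
      exact setIntegral_Ioi_pos (hf.integrableOn_payoff k) fun x hx =>
        mul_pos (sub_pos.2 (Real.exp_lt_exp.2 hx)) (hpos x (hk.trans_lt hx).ne')
    set L := symmCall (survival f) k
    obtain ⟨w₂, h2, hw₂⟩ := (((tendsto_bsPrice_atTop k).eventually (lt_mem_nhds hlt)).and
      (eventually_ge_atTop L)).exists
    have hle : bsPrice k L ≤ L := bsPrice_le hk hgt
    obtain ⟨w, hw, hwL⟩ := intermediate_value_Icc hw₂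
      ((continuousOn_bsPrice k).mono fun x hx => hgt.trans_le hx.1) ⟨hle, h2.le⟩
    exact ⟨w, hgt.trans_le hw.1, hwL.symm⟩
  rcases le_total 0 k with hk | hk
  · exact key k hk
  · obtain ⟨w, hw, h⟩ := key (-k) (neg_nonneg.2 hk)
    refine ⟨w, hw, ?_⟩
    rw [bsPrice, symmCall_neg, symmCall_neg, ← bsPrice] at h
    exact mul_left_cancel₀ (Real.exp_pos (-k)).ne' (by linarith)

/-! ### Comparing the call prices of two densities -/

lemma hasDerivAt_symmCall (hf : IsSymmetricDensity f) (k : ℝ) :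
    HasDerivAt (symmCall (survival f)) (-(Real.exp k * survival f k)) k := by
  have h1 : HasDerivAt (fun k => survival f (-k)) (f (-k)) k := by
    have := (hf.hasDerivAt_survival (-k)).comp k (hasDerivAt_neg k)
    simpa [Function.comp_def] using this
  have h2 := (Real.hasDerivAt_exp k).mul (hf.hasDerivAt_survival k)
  refine ((h1.const_sub 1).sub h2).congr_deriv ?_
  rw [← hf.exp_mul]; ring

end IsSymmetricDensity

/-- The difference of the normalized call prices belonging to the densities `f` and `g`. -/
def callGap (f g : ℝ → ℝ) (k : ℝ) : ℝ := symmCall (survival f) k - symmCall (survival g) k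

lemma callGap_neg (f g : ℝ → ℝ) (k : ℝ) : callGap f g (-k) = Real.exp (-k) * callGap f g k := by
  simp only [callGap, symmCall_neg]; ring

section CallGap

variable {f g : ℝ → ℝ}

lemma hasDerivAt_callGap (hf : IsSymmetricDensity f) (hg : IsSymmetricDensity g) (k : ℝ) :
    HasDerivAt (callGap f g) (-(Real.exp k * (survival f k - survival g k))) k :=
  ((hf.hasDerivAt_symmCall k).sub (hg.hasDerivAt_symmCall k)).congr_deriv (by ring)

lemma hasDerivAt_survival_sub (hf : IsSymmetricDensity f) (hg : IsSymmetricDensity g) (k : ℝ) :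
    HasDerivAt (fun x => survival f x - survival g x) (-(f k - g k)) k :=
  ((hf.hasDerivAt_survival k).sub (hg.hasDerivAt_survival k)).congr_deriv (by ring)

lemma continuous_callGap (hf : IsSymmetricDensity f) (hg : IsSymmetricDensity g) :
    Continuous (callGap f g) :=
  continuous_iff_continuousAt.2 fun k => (hasDerivAt_callGap hf hg k).continuousAt

/-- A heavier right tail makes the far out-of-the-money calls more expensive. -/
lemma eventually_callGap_pos (hf : IsSymmetricDensity f) (hg : IsSymmetricDensity g)
    (h : ∀ᶠ x in atTop, g x < f x) : ∃ R, 0 < R ∧ ∀ k, R ≤ k → 0 < callGap f g k := by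
  obtain ⟨R, hR⟩ := eventually_atTop.1 h
  refine ⟨max R 1, by positivity, fun k hk => ?_⟩
  have hint := (hf.integrableOn_payoff k).sub (hg.integrableOn_payoff k)
  rw [callGap, ← hf.integral_payoff, ← hg.integral_payoff,
    ← integral_sub' (hf.integrableOn_payoff k) (hg.integrableOn_payoff k)]
  refine setIntegral_Ioi_pos hint fun x hx => ?_
  simp only [Pi.sub_apply, ← mul_sub]
  exact mul_pos (sub_pos.2 (Real.exp_lt_exp.2 hx))
    (sub_pos.2 (hR x ((le_max_left _ _).trans (hk.trans hx.le))))

/-- If two densities give the same at-the-money price but `f` has a dip below `g` at `0`, then the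
calls slightly off the money are strictly cheaper under `f`. -/
lemma exists_callGap_neg (hf : IsSymmetricDensity f) (hg : IsSymmetricDensity g)
    (h0 : callGap f g 0 = 0) (hdip : f 0 < g 0) : ∃ k, 0 < k ∧ callGap f g k < 0 := by
  obtain ⟨δ, hδ, hlt⟩ : ∃ δ, 0 < δ ∧ ∀ x, 0 ≤ x → x ≤ δ → f x < g x := by
    have hev : ∀ᶠ x in 𝓝 (0 : ℝ), f x < g x :=
      hf.continuous.continuousAt.eventually_lt hg.continuous.continuousAt hdip
    obtain ⟨ε, hε, h⟩ := Metric.eventually_nhds_iff.1 hev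
    refine ⟨ε / 2, half_pos hε, fun x hx hx' => h ?_⟩
    rw [Real.dist_eq, sub_zero, abs_of_nonneg hx]
    linarith
  have hE0 : survival f 0 - survival g 0 = 0 := by
    simp only [callGap, symmCall_zero] at h0; linarith
  have hE : ∀ x, 0 < x → x ≤ δ → 0 < survival f x - survival g x := by
    have hmono : StrictMonoOn (fun x => survival f x - survival g x) (Icc 0 δ) := by
      refine strictMonoOn_of_deriv_pos (convex_Icc 0 δ)
        (fun x _ => (hasDerivAt_survival_sub hf hg x).continuousAt.continuousWithinAt)
        fun x hx => ?_
      rw [interior_Icc] at hx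
      rw [(hasDerivAt_survival_sub hf hg x).deriv]
      linarith [hlt x hx.1.le hx.2.le]
    intro x hx hx'
    have := hmono (left_mem_Icc.2 hδ.le) ⟨hx.le, hx'⟩ hx
    simp only [hE0] at this
    exact this
  have hanti : StrictAntiOn (callGap f g) (Icc 0 δ) := by
    refine strictAntiOn_of_deriv_neg (convex_Icc 0 δ) (continuous_callGap hf hg).continuousOn
      fun x hx => ?_
    rw [interior_Icc] at hx
    rw [(hasDerivAt_callGap hf hg x).deriv]
    exact neg_neg_of_pos (mul_pos (Real.exp_pos x) (hE x hx.1 hx.2.le))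
  refine ⟨δ, hδ, ?_⟩
  have := hanti (left_mem_Icc.2 hδ.le) (right_mem_Icc.2 hδ.le) hδ
  rwa [h0] at this

/-- Rolle's theorem for accumulating zeros. -/
lemma frequently_deriv_eq_zero {F F' : ℝ → ℝ} (hF : ∀ x, HasDerivAt F (F' x) x) {x₀ : ℝ}
    (h : ∃ᶠ y in 𝓝[≠] x₀, F y = 0) : ∃ᶠ y in 𝓝[≠] x₀, F' y = 0 := by
  have hcont : Continuous F := continuous_iff_continuousAt.2 fun x => (hF x).continuousAt
  have hx₀ : F x₀ = 0 := by
    have hcl : IsClosed {y | F y = 0} := isClosed_singleton.preimage hcont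
    exact hcl.mem_of_frequently_of_tendsto h (tendsto_id.mono_left nhdsWithin_le_nhds)
  rw [frequently_nhdsWithin_iff] at h ⊢
  rw [Metric.nhds_basis_ball.frequently_iff] at h ⊢
  intro ε hε
  obtain ⟨y, hy, hFy, hne⟩ := h ε hε
  rw [Real.ball_eq_Ioo] at hy ⊢
  rcases lt_or_gt_of_ne (show y ≠ x₀ from hne) with hlt | hlt
  · obtain ⟨z, hz, hz'⟩ := exists_hasDerivAt_eq_zero hlt hcont.continuousOn (hFy.trans hx₀.symm)
      fun x _ => hF x
    exact ⟨z, ⟨hy.1.trans hz.1, by linarith [hz.2]⟩, hz', hz.2.ne⟩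
  · obtain ⟨z, hz, hz'⟩ := exists_hasDerivAt_eq_zero hlt hcont.continuousOn (hx₀.trans hFy.symm)
      fun x _ => hF x
    exact ⟨z, ⟨by linarith [hz.1], hz.2.trans hy.2⟩, hz', hz.1.ne'⟩

/-- The price difference has only finitely many zeros: an accumulation point of zeros would, by
Rolle's theorem applied twice, be an accumulation point of zeros of the analytic function `f - g`,
which is positive far out. -/
lemma finite_zeros_callGap (hf : IsSymmetricDensity f) (hg : IsSymmetricDensity g)
    (hfa : AnalyticOnNhd ℝ f (Ioi 0)) (hga : AnalyticOnNhd ℝ g (Ioi 0))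
    (h : ∀ᶠ x in atTop, g x < f x) (h0 : callGap f g 0 ≠ 0) :
    {k | callGap f g k = 0}.Finite := by
  obtain ⟨R, -, hR⟩ := eventually_callGap_pos hf hg h
  have hcont := continuous_callGap hf hg
  set Z := {k | callGap f g k = 0} with hZ
  have hright : (Z ∩ Ici 0).Finite := by
    by_contra hinf
    have hsub : Z ∩ Ici 0 ⊆ Icc 0 R := fun k hk =>
      ⟨hk.2, not_lt.1 fun hlt => (hR k hlt.le).ne' hk.1⟩
    obtain ⟨x₀, hx₀, hacc⟩ :=
      Set.Infinite.exists_accPt_of_subset_isCompact hinf isCompact_Icc hsub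
    have hfreq : ∃ᶠ y in 𝓝[≠] x₀, callGap f g y = 0 :=
      (accPt_iff_frequently_nhdsNE.1 hacc).mono fun y hy => hy.1
    have hx₀z : callGap f g x₀ = 0 :=
      (isClosed_singleton.preimage hcont : IsClosed Z).mem_of_frequently_of_tendsto hfreq
        (tendsto_id.mono_left nhdsWithin_le_nhds)
    have hx₀pos : 0 < x₀ := lt_of_le_of_ne hx₀.1 fun he => h0 (he ▸ hx₀z)
    have h1 : ∃ᶠ y in 𝓝[≠] x₀, survival f y - survival g y = 0 :=
      (frequently_deriv_eq_zero (hasDerivAt_callGap hf hg) hfreq).mono fun y hy => by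
        simpa [(Real.exp_pos y).ne'] using hy
    have h2 : ∃ᶠ y in 𝓝[≠] x₀, (f - g) y = 0 :=
      (frequently_deriv_eq_zero (hasDerivAt_survival_sub hf hg) h1).mono fun y hy => by
        exact neg_eq_zero.1 hy
    have hzero := (hfa.sub hga).eqOn_zero_of_preconnected_of_frequently_eq_zero
      isPreconnected_Ioi hx₀pos h2
    obtain ⟨x, hx, hx'⟩ := (h.and (eventually_gt_atTop 0)).exists
    have := hzero hx'
    simp only [Pi.sub_apply, Pi.zero_apply] at this
    linarith
  refine (hright.union (hright.image Neg.neg)).subset fun k hk => ?_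
  rcases le_total 0 k with hk0 | hk0
  · exact Or.inl ⟨hk, hk0⟩
  · refine Or.inr ⟨-k, ⟨?_, neg_nonneg.2 hk0⟩, neg_neg k⟩
    change callGap f g (-k) = 0
    rw [callGap_neg, show callGap f g k = 0 from hk, mul_zero]

end CallGap

/-! ### Counting sign changes -/

section SignChanges

variable {h D : ℝ → ℝ} {n : ℕ}

lemma AlternatesAlong.congr_sign {k : Fin (n + 1) → ℝ} (hk : AlternatesAlong h k)
    (hpos : ∀ K, 0 < K → (0 < h K ↔ 0 < D K)) (hneg : ∀ K, 0 < K → (h K < 0 ↔ D K < 0)) :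
    AlternatesAlong D k := by
  obtain ⟨h1, h2, h3, h4⟩ := hk
  refine ⟨h1, h2, fun i => ?_, fun i => ?_⟩
  · rcases lt_or_gt_of_ne (h3 i) with hi | hi
    · exact ((hneg _ (h2 i)).1 hi).ne
    · exact ((hpos _ (h2 i)).1 hi).ne'
  · rcases mul_neg_iff.1 (h4 i) with ⟨ha, hb⟩ | ⟨ha, hb⟩
    · exact mul_neg_of_pos_of_neg ((hpos _ (h2 _)).1 ha) ((hneg _ (h2 _)).1 hb)
    · exact mul_neg_of_neg_of_pos ((hneg _ (h2 _)).1 ha) ((hpos _ (h2 _)).1 hb)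

/-- By the intermediate value theorem there are at most as many sign changes as zeros. -/
lemma AlternatesAlong.le_card_zeros {k : Fin (n + 1) → ℝ} (hk : AlternatesAlong D k)
    (hD : ContinuousOn D (Ioi 0)) (hfin : {K | 0 < K ∧ D K = 0}.Finite) :
    n ≤ hfin.toFinset.card := by
  obtain ⟨hmono, hpos, -, halt⟩ := hk
  have hz : ∀ i : Fin n, ∃ z, k i.castSucc < z ∧ z < k i.succ ∧ D z = 0 := by
    intro i
    have hlt : k i.castSucc < k i.succ := hmono Fin.castSucc_lt_succ
    have hc : ContinuousOn D (Icc (k i.castSucc) (k i.succ)) :=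
      hD.mono fun x hx => (hpos _).trans_le hx.1
    rcases mul_neg_iff.1 (halt i) with ⟨ha, hb⟩ | ⟨ha, hb⟩
    · obtain ⟨z, hz, hz0⟩ := intermediate_value_Ioo' hlt.le hc ⟨hb, ha⟩
      exact ⟨z, hz.1, hz.2, hz0⟩
    · obtain ⟨z, hz, hz0⟩ := intermediate_value_Ioo hlt.le hc ⟨ha, hb⟩
      exact ⟨z, hz.1, hz.2, hz0⟩
  choose z hz1 hz2 hz3 using hz
  have hzmono : StrictMono z := fun i j hij =>
    (hz2 i).trans ((hmono.monotone (Fin.succ_le_castSucc_iff.2 hij)).trans_lt (hz1 j))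
  have := Finset.card_le_card_of_injOn (s := Finset.univ) (t := hfin.toFinset) z
    (fun i _ => by simpa using ⟨(hpos _).trans (hz1 i), hz3 i⟩) hzmono.injective.injOn
  simpa using this

lemma AlternatesAlong.cons {k : Fin (n + 1) → ℝ} (hk : AlternatesAlong D k) {a : ℝ} (ha : 0 < a)
    (hak : a < k 0) (hs : D a * D (k 0) < 0) :
    AlternatesAlong D (Fin.cons a k : Fin (n + 1 + 1) → ℝ) := by
  obtain ⟨h1, h2, h3, h4⟩ := hk
  refine ⟨?_, fun i => ?_, fun i => ?_, fun i => ?_⟩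
  · refine Fin.strictMono_iff_lt_succ.2 fun i => ?_
    refine Fin.cases ?_ (fun j => ?_) i
    · simpa using hak
    · rw [Fin.castSucc_succ, Fin.cons_succ, Fin.cons_succ]
      exact h1 Fin.castSucc_lt_succ
  · refine Fin.cases ?_ (fun j => ?_) i
    · simpa using ha
    · simpa using h2 j
  · refine Fin.cases ?_ (fun j => ?_) i
    · simpa using (left_ne_zero_of_mul hs.ne)
    · simpa using h3 j
  · refine Fin.cases ?_ (fun j => ?_) i
    · simpa using hs
    · rw [Fin.castSucc_succ, Fin.cons_succ, Fin.cons_succ]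
      exact h4 j

lemma AlternatesAlong.snoc {k : Fin (n + 1) → ℝ} (hk : AlternatesAlong D k) {a : ℝ}
    (hak : k (Fin.last n) < a) (hs : D (k (Fin.last n)) * D a < 0) :
    AlternatesAlong D (Fin.snoc k a : Fin (n + 1 + 1) → ℝ) := by
  obtain ⟨h1, h2, h3, h4⟩ := hk
  refine ⟨?_, fun i => ?_, fun i => ?_, fun i => ?_⟩
  · refine Fin.strictMono_iff_lt_succ.2 fun i => ?_
    refine Fin.lastCases ?_ (fun j => ?_) i
    · rw [Fin.succ_last, Fin.snoc_castSucc, Fin.snoc_last]; exact hak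
    · rw [Fin.succ_castSucc, Fin.snoc_castSucc, Fin.snoc_castSucc]
      exact h1 Fin.castSucc_lt_succ
  · refine Fin.lastCases ?_ (fun j => ?_) i
    · rw [Fin.snoc_last]; exact (h2 _).trans hak
    · rw [Fin.snoc_castSucc]; exact h2 j
  · refine Fin.lastCases ?_ (fun j => ?_) i
    · rw [Fin.snoc_last]; exact right_ne_zero_of_mul hs.ne
    · rw [Fin.snoc_castSucc]; exact h3 j
  · refine Fin.lastCases ?_ (fun j => ?_) i
    · rw [Fin.succ_last, Fin.snoc_castSucc, Fin.snoc_last]; exact hs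
    · rw [Fin.succ_castSucc, Fin.snoc_castSucc, Fin.snoc_castSucc]
      exact h4 j

lemma AlternatesAlong.even {k : Fin (n + 1) → ℝ} (hk : AlternatesAlong D k) (h0 : 0 < D (k 0))
    (hl : 0 < D (k (Fin.last n))) : Even n := by
  obtain ⟨-, -, -, h4⟩ := hk
  have key : ∀ i : Fin (n + 1), 0 < (-1) ^ (i : ℕ) * D (k i) := by
    intro i
    refine Fin.induction ?_ (fun j hj => ?_) i
    · simpa using h0
    · rw [Fin.val_castSucc] at hj
      rw [Fin.val_succ, pow_succ]
      have h := h4 j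
      rcases neg_one_pow_eq_or ℝ (j : ℕ) with e | e <;> rw [e] at hj ⊢ <;> nlinarith
  by_contra hodd
  have := key (Fin.last n)
  rw [Fin.val_last, (Nat.not_even_iff_odd.1 hodd).neg_one_pow] at this
  linarith

/-- A continuous function on `(0, ∞)` with finitely many zeros, positive near `0` and near `∞`, has
a maximal number of sign changes; by maximality such a sequence starts and ends with `+`, so that
its length is even. -/
lemma exists_even_max_alternation (hD : ContinuousOn D (Ioi 0))
    (hfin : {K | 0 < K ∧ D K = 0}.Finite) {ε R : ℝ} (hε : 0 < ε)
    (hleft : ∀ K, 0 < K → K ≤ ε → 0 < D K) (hright : ∀ K, R ≤ K → 0 < D K) {m : ℕ}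
    (hm : ∃ k : Fin (m + 1) → ℝ, AlternatesAlong D k) :
    ∃ d, Even d ∧ m ≤ d ∧
      (∃ k : Fin (d + 1) → ℝ, AlternatesAlong D k ∧ 0 < D (k 0) ∧ 0 < D (k (Fin.last d))) ∧
      ¬ ∃ k : Fin (d + 1 + 1) → ℝ, AlternatesAlong D k := by
  classical
  let P : ℕ → Prop := fun n => ∃ k : Fin (n + 1) → ℝ, AlternatesAlong D k
  have hbound : ∀ n, P n → n ≤ hfin.toFinset.card := fun n ⟨_, hk⟩ => hk.le_card_zeros hD hfin
  let d := Nat.findGreatest P hfin.toFinset.card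
  have hmd : m ≤ d := Nat.le_findGreatest (hbound m hm) hm
  obtain ⟨k, hk⟩ : P d := Nat.findGreatest_spec (hbound m hm) hm
  have hmax : ¬ P (d + 1) := fun h => by
    have : d + 1 ≤ d := Nat.le_findGreatest (hbound _ h) h
    omega
  have h0 : 0 < D (k 0) := by
    by_contra hneg
    have hlt : D (k 0) < 0 := lt_of_le_of_ne (not_lt.1 hneg) (hk.2.2.1 0)
    have hk0 := hk.2.1 0
    have ha : 0 < min ε (k 0 / 2) := lt_min hε (half_pos hk0)
    exact hmax ⟨_, hk.cons ha ((min_le_right _ _).trans_lt (half_lt_self hk0))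
      (mul_neg_of_pos_of_neg (hleft _ ha (min_le_left _ _)) hlt)⟩
  have hl : 0 < D (k (Fin.last d)) := by
    by_contra hneg
    have hlt : D (k (Fin.last d)) < 0 := lt_of_le_of_ne (not_lt.1 hneg) (hk.2.2.1 _)
    refine hmax ⟨_, hk.snoc (a := max R (k (Fin.last d) + 1)) ?_
      (mul_neg_of_neg_of_pos hlt (hright _ (le_max_left _ _)))⟩
    exact (lt_add_one _).trans_le (le_max_right _ _)
  exact ⟨d, hk.even h0 hl, hmd, ⟨k, hk, h0, hl⟩, hmax⟩

end SignChanges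

/-! ### From a dip at zero to a W-shaped smile -/

/-- A symmetric density which is positive away from `0`, real analytic on `(0, ∞)`, and whose right
tail is at least exponential. -/
structure IsSmileDensity (f : ℝ → ℝ) : Prop extends IsSymmetricDensity f where
  pos : ∀ x, x ≠ 0 → 0 < f x
  analytic : AnalyticOnNhd ℝ f (Ioi 0)
  tail : ∃ δ M : ℝ, 0 < δ ∧ ∀ x, 1 ≤ x → δ * Real.exp (-M * x) ≤ f x

lemma analyticOnNhd_bsDensity (w : ℝ) (s : Set ℝ) : AnalyticOnNhd ℝ (bsDensity w) s := by
  intro x _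
  unfold bsDensity
  have h : AnalyticAt ℝ (fun x : ℝ => -(1 / 2) * (x / w + w / 2) ^ 2) x := by
    simp only [div_eq_mul_inv]
    fun_prop
  exact analyticAt_const.mul h.rexp'

lemma callGap_bsDensity (f : ℝ → ℝ) {w : ℝ} (hw : 0 < w) (k : ℝ) :
    callGap f (bsDensity w) k = symmCall (survival f) k - bsPrice k w := by
  rw [callGap, bsPrice, show survival (bsDensity w) = bsSurvival w from
    funext (survival_bsDensity hw)]

namespace IsSmileDensity

variable {f : ℝ → ℝ}

lemma semiHeavyTails (hf : IsSmileDensity f) : SemiHeavyTails f := by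
  obtain ⟨δ, M, hδ, hM⟩ := hf.tail
  refine ⟨M, fun r hr => not_lt.1 fun hlt => ?_⟩
  have hr' : IntegrableOn (fun x : ℝ => Real.exp (r * x) * f x) (Ioi 1) := Integrable.integrableOn hr
  have hconst : IntegrableOn (fun _ : ℝ => δ) (Ioi 1) := by
    refine Integrable.mono' hr' aestronglyMeasurable_const ?_
    refine (ae_restrict_iff' measurableSet_Ioi).2 (Eventually.of_forall fun x hx => ?_)
    have hx1 : (1 : ℝ) ≤ x := le_of_lt hx
    rw [Real.norm_of_nonneg hδ.le]
    calc δ ≤ δ * Real.exp ((r - M) * x) :=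
          le_mul_of_one_le_right hδ.le (Real.one_le_exp (by nlinarith))
      _ = Real.exp (r * x) * (δ * Real.exp (-M * x)) := by
          rw [mul_left_comm, ← Real.exp_add]; ring_nf
      _ ≤ _ := by gcongr; exact hM x hx1
  rw [integrableOn_const_iff] at hconst
  simp [hδ.ne'] at hconst

lemma eventually_bsDensity_lt (hf : IsSmileDensity f) {w : ℝ} (hw : 0 < w) :
    ∀ᶠ x in atTop, bsDensity w x < f x := by
  obtain ⟨δ, M, hδ, hM⟩ := hf.tail
  have h1 : Tendsto (fun x : ℝ => x * (x * (1 / (2 * w ^ 2)) + (1 / 2 - M)) + w ^ 2 / 8)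
      atTop atTop :=
    tendsto_atTop_add_const_right _ _ (tendsto_id.atTop_mul_atTop₀
      (tendsto_atTop_add_const_right _ _ (tendsto_id.atTop_mul_const (by positivity))))
  have h2 := (Real.tendsto_exp_neg_atTop_nhds_zero.comp h1).const_mul (1 / (√(2 * Real.pi) * w))
  rw [mul_zero] at h2
  filter_upwards [h2.eventually (gt_mem_nhds hδ), eventually_ge_atTop 1] with x hx hx1
  refine lt_of_lt_of_le ?_ (hM x hx1)
  have he := mul_lt_mul_of_pos_right hx (Real.exp_pos (-M * x))
  refine lt_of_eq_of_lt ?_ he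
  rw [bsDensity, mul_assoc, Function.comp_apply, ← Real.exp_add]
  congr 2
  field_simp
  ring

/-- Suppose the density has a dip at zero relative to the normal density of the at-the-money total
volatility `w₀`. At a slightly smaller volatility `w`, the call is dearer than the Black–Scholes
call at the money but still cheaper somewhere off the money. -/
lemma exists_callGap_pos_zero_neg (hf : IsSmileDensity f) {w₀ : ℝ} (hw₀ : 0 < w₀)
    (h0 : callGap f (bsDensity w₀) 0 = 0) (hdip : f 0 < bsDensity w₀ 0) :
    ∃ w, 0 < w ∧ 0 < callGap f (bsDensity w) 0 ∧ ∃ k, 0 < k ∧ callGap f (bsDensity w) k < 0 := by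
  obtain ⟨k, hk, hneg⟩ := exists_callGap_neg hf.toIsSymmetricDensity
    (isSymmetricDensity_bsDensity hw₀) h0 hdip
  rw [callGap_bsDensity f hw₀] at h0 hneg
  have hev : ∀ᶠ w in 𝓝[<] w₀, symmCall (survival f) k < bsPrice k w :=
    ((hasDerivAt_bsPrice k hw₀).continuousAt.eventually (lt_mem_nhds (sub_neg.1 hneg))).filter_mono
      nhdsWithin_le_nhds
  obtain ⟨w, hlt, hw⟩ := (hev.and (Ioo_mem_nhdsLT hw₀)).exists
  refine ⟨w, hw.1, ?_, k, hk, ?_⟩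
  · rw [callGap_bsDensity f hw.1]
    linarith [strictMonoOn_bsPrice 0 (mem_Ioi.2 hw.1) (mem_Ioi.2 hw₀) hw.2]
  · rw [callGap_bsDensity f hw.1]; linarith

/-- The implied volatility exists. The second property restates its defining equation in
normalized prices. -/
theorem exists_impliedVolatility (hf : IsSmileDensity f) {S₀ T : ℝ} (hS : 0 < S₀) (hT : 0 < T) :
    ∃ σ : ℝ → ℝ, IsImpliedVolatility f S₀ T σ ∧
      ∀ K, 0 < K → symmCall (survival f) (Real.log (K / S₀))
        = bsPrice (Real.log (K / S₀)) (σ K * √T) := by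
  have hsT : 0 < √T := Real.sqrt_pos.2 hT
  choose w hw hwk using hf.exists_bsPrice_eq hf.pos
  have hmul : ∀ k, w k / √T * √T = w k := fun k => div_mul_cancel₀ _ hsT.ne'
  refine ⟨fun K => w (Real.log (K / S₀)) / √T, fun K hK => ?_, fun K _ => ?_⟩
  · have hσ : 0 < w (Real.log (K / S₀)) / √T := div_pos (hw _) hsT
    refine ⟨hσ, ?_, fun s hs h => ?_⟩
    · rw [hf.callPrice_eq hS hK, bsCall_eq hS hK hT hσ, hmul, hwk]
    · rw [hf.callPrice_eq hS hK, bsCall_eq hS hK hT hs, hwk] at h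
      have := (strictMonoOn_bsPrice _).injOn (hw _) (mul_pos hs hsT)
        (mul_left_cancel₀ hS.ne' h)
      rw [eq_div_iff hsT.ne', this]
  · rw [hmul, hwk]

/-- A dip at zero makes the smile (W+)-shaped: at a level slightly below the at-the-money
volatility, the signs at log-moneyness `-R, -k₁, 0, k₁, R` are `+ - + - +`, and a maximal sequence of
sign changes has the required form. -/
theorem isWPlusShaped (hf : IsSmileDensity f) {S₀ T : ℝ} (hS : 0 < S₀) (hT : 0 < T) {σ : ℝ → ℝ}
    (hσ : ∀ K, 0 < K → 0 < σ K)
    (hσ' : ∀ K, 0 < K → symmCall (survival f) (Real.log (K / S₀))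
        = bsPrice (Real.log (K / S₀)) (σ K * √T))
    (hdip : DipAtZero f (σ S₀ * √T)) : IsWPlusShaped σ := by
  have hsT : 0 < √T := Real.sqrt_pos.2 hT
  have hw₀ : 0 < σ S₀ * √T := mul_pos (hσ _ hS) hsT
  have hATM := hσ' S₀ hS
  rw [div_self hS.ne', Real.log_one] at hATM
  obtain ⟨w, hw, hpos0, k₁, hk₁, hneg⟩ := hf.exists_callGap_pos_zero_neg hw₀
    (by rw [callGap_bsDensity f hw₀, hATM, sub_self]) hdip
  have hg := isSymmetricDensity_bsDensity hw
  obtain ⟨R, hR, hRpos⟩ := eventually_callGap_pos hf.toIsSymmetricDensity hg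
    (hf.eventually_bsDensity_lt hw)
  have hfin := finite_zeros_callGap hf.toIsSymmetricDensity hg hf.analytic
    (analyticOnNhd_bsDensity w _) (hf.eventually_bsDensity_lt hw) hpos0.ne'
  set G := callGap f (bsDensity w) with hG
  have hRneg : ∀ k, k ≤ -R → 0 < G k := fun k hk => by
    rw [← neg_neg k, hG, callGap_neg]
    exact mul_pos (Real.exp_pos _) (hRpos _ (by linarith))
  have hneg' : G (-k₁) < 0 := by
    rw [hG, callGap_neg]
    exact mul_neg_of_pos_of_neg (Real.exp_pos _) hneg
  have hk₁R : k₁ < R := not_le.1 fun h => (hRpos _ h).not_gt hneg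
  -- the price difference as a function of the strike
  let D : ℝ → ℝ := fun K => G (Real.log (K / S₀))
  have hDexp : ∀ k, D (S₀ * Real.exp k) = G k := fun k => by
    simp only [D, mul_div_cancel_left₀ _ hS.ne', Real.log_exp]
  have hD : ContinuousOn D (Ioi 0) := by
    refine (continuous_callGap hf.toIsSymmetricDensity hg).comp_continuousOn ?_
    exact ContinuousOn.log (by fun_prop) fun K hK => (div_pos hK hS).ne'
  have hDfin : {K | 0 < K ∧ D K = 0}.Finite := by
    refine (hfin.image fun k => S₀ * Real.exp k).subset fun K hK => ?_
    refine ⟨Real.log (K / S₀), hK.2, ?_⟩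
    simp only [Real.exp_log (div_pos hK.1 hS)]
    field_simp
  have hleft : ∀ K, 0 < K → K ≤ S₀ * Real.exp (-R) → 0 < D K := fun K hK hKR => by
    refine hRneg _ ?_
    rw [Real.log_le_iff_le_exp (div_pos hK hS), div_le_iff₀ hS]
    linarith
  have hright : ∀ K, S₀ * Real.exp R ≤ K → 0 < D K := fun K hK => by
    have hK0 : 0 < K := (by positivity : 0 < S₀ * Real.exp R).trans_le hK
    refine hRpos _ ?_
    rw [Real.le_log_iff_exp_le (div_pos hK0 hS), le_div_iff₀ hS]
    linarith
  have h4 : ∃ k : Fin (4 + 1) → ℝ, AlternatesAlong D k := by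
    have hlt : ∀ {a b : ℝ}, a < b → S₀ * Real.exp a < S₀ * Real.exp b := fun h =>
      mul_lt_mul_of_pos_left (Real.exp_lt_exp.2 h) hS
    have a0 := hRneg (-R) le_rfl
    have a4 := hRpos R le_rfl
    refine ⟨fun i => S₀ * Real.exp ((![-R, -k₁, 0, k₁, R] : Fin 5 → ℝ) i), ?_, fun i => by positivity,
      fun i => ?_, fun i => ?_⟩
    · refine Fin.strictMono_iff_lt_succ.2 fun i => hlt ?_
      fin_cases i
      · simpa using hk₁R
      · simpa using hk₁
      · simpa using hk₁
      · simpa using hk₁R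
    · rw [hDexp]
      fin_cases i
      exacts [a0.ne', hneg'.ne, hpos0.ne', hneg.ne, a4.ne']
    · rw [hDexp, hDexp]
      fin_cases i
      exacts [mul_neg_of_pos_of_neg a0 hneg', mul_neg_of_neg_of_pos hneg' hpos0,
        mul_neg_of_pos_of_neg hpos0 hneg, mul_neg_of_neg_of_pos hneg a4]
  -- by positivity of vega, the implied volatility lies above a level exactly where the price does
  have hDK : ∀ K, 0 < K → D K = bsPrice (Real.log (K / S₀)) (σ K * √T)
      - bsPrice (Real.log (K / S₀)) w := fun K hK => by
    simp only [D]; rw [hG, callGap_bsDensity f hw, hσ' K hK]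
  have hpos_iff : ∀ K, 0 < K → (0 < D K ↔ 0 < σ K - w / √T) := fun K hK => by
    rw [hDK K hK, sub_pos, sub_pos, div_lt_iff₀ hsT]
    exact (strictMonoOn_bsPrice _).lt_iff_lt hw (mul_pos (hσ K hK) hsT)
  have hneg_iff : ∀ K, 0 < K → (D K < 0 ↔ σ K - w / √T < 0) := fun K hK => by
    rw [hDK K hK, sub_neg, sub_neg, lt_div_iff₀ hsT]
    exact (strictMonoOn_bsPrice _).lt_iff_lt (mul_pos (hσ K hK) hsT) hw
  obtain ⟨d, hd, h4d, ⟨k, hk, hk0, hkl⟩, hmax⟩ :=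
    exists_even_max_alternation hD hDfin (by positivity : 0 < S₀ * Real.exp (-R)) hleft hright h4
  refine ⟨w / √T, div_pos hw hsT, d, hd, h4d, ⟨k, hk.congr_sign hpos_iff hneg_iff,
    (hpos_iff _ (hk.2.1 _)).1 hk0, (hpos_iff _ (hk.2.1 _)).1 hkl⟩, ?_⟩
  rintro ⟨k', hk'⟩
  exact hmax ⟨k', hk'.congr_sign (fun K hK => (hpos_iff K hK).symm)
    fun K hK => (hneg_iff K hK).symm⟩

end IsSmileDensity

/-! ### The double gamma density -/

section DoubleGamma

variable {c lam μ T : ℝ}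

lemma mixA_pos (hlam : 0 < lam) (hμ : 0 < μ) : 0 < mixA c lam μ T := by
  unfold mixA; positivity

lemma mixB_pos (hlam : 0 < lam) (hμlam : μ < 2 * lam) : 0 < mixB c lam μ T := by
  have : 0 < 1 - μ / (2 * lam) := by rw [sub_pos, div_lt_one (by positivity)]; exact hμlam
  unfold mixB; positivity

/-- The weighted normalizing constants of the two halves agree; this is what makes the double gamma
density geometrically symmetric. -/
lemma mixA_mul_rpow (hlam : 0 < lam) (hμ : 0 < μ) (hμlam : μ < 2 * lam) :
    mixA c lam μ T * (lam / μ - 1 / 2) ^ (c * T) = mixB c lam μ T * (lam / μ + 1 / 2) ^ (c * T) := by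
  have h1 : 0 < 1 - μ / (2 * lam) := by rw [sub_pos, div_lt_one (by positivity)]; exact hμlam
  have h2 : 0 < lam / μ - 1 / 2 := by
    rw [sub_pos, div_lt_div_iff₀ two_pos hμ]; linarith
  rw [mixA, mixB, ← Real.mul_rpow (by positivity) h2.le, ← Real.mul_rpow h1.le (by positivity)]
  congr 1
  field_simp

/-- The density of the gamma distribution with shape `p` and rate `r`. -/
def gammaDensity (p r x : ℝ) : ℝ :=
  if 0 < x then r ^ p / Real.Gamma p * x ^ (p - 1) * Real.exp (-r * x) else 0

lemma integral_gammaDensity {p r : ℝ} (hp : 0 < p) (hr : 0 < r) :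
    ∫ x, gammaDensity p r x = 1 := by
  have hG := Real.Gamma_pos_of_pos hp
  have h : gammaDensity p r = (Ioi 0).indicator
      (fun x => r ^ p / Real.Gamma p * (x ^ (p - 1) * Real.exp (-(r * x)))) := by
    funext x
    rw [indicator_apply]
    simp only [gammaDensity, mem_Ioi, mul_assoc, neg_mul]
  rw [h, integral_indicator measurableSet_Ioi, integral_const_mul,
    Real.integral_rpow_mul_exp_neg_mul_Ioi hp hr, Real.div_rpow zero_le_one hr.le, Real.one_rpow]
  field_simp

lemma continuous_gammaDensity {p : ℝ} (hp : 1 < p) (r : ℝ) : Continuous (gammaDensity p r) := by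
  have h : gammaDensity p r
      = fun x : ℝ => r ^ p / Real.Gamma p * (max x 0) ^ (p - 1) * Real.exp (-r * x) := by
    funext x
    rw [gammaDensity]
    split_ifs with hx
    · rw [max_eq_left hx.le]
    · rw [max_eq_right (not_lt.1 hx), Real.zero_rpow (by linarith)]; simp
  rw [h]
  have : Continuous fun x : ℝ => (max x 0) ^ (p - 1) :=
    (continuous_id.max continuous_const).rpow_const fun x => Or.inr (by linarith)
  fun_prop

lemma doubleGammaDensity_eq (x : ℝ) : doubleGammaDensity c lam μ T x =
    mixA c lam μ T / (mixA c lam μ T + mixB c lam μ T)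
        * gammaDensity (c * T) (lam / μ - 1 / 2) (-x)
      + mixB c lam μ T / (mixA c lam μ T + mixB c lam μ T)
        * gammaDensity (c * T) (lam / μ + 1 / 2) x := by
  simp only [doubleGammaDensity, gammaDensity, Left.neg_pos_iff, neg_mul_neg]

theorem isSmileDensity_doubleGammaDensity (hlam : 0 < lam) (hμ : 0 < μ) (hμlam : μ < 2 * lam)
    (hcT : 1 < c * T) : IsSmileDensity (doubleGammaDensity c lam μ T) := by
  have hA := mixA_pos (c := c) (T := T) hlam hμ
  have hB := mixB_pos (c := c) (T := T) hlam hμlam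
  have hm : 0 < lam / μ - 1 / 2 := by
    rw [sub_pos, div_lt_div_iff₀ two_pos hμ]; linarith
  have hp : 0 < lam / μ + 1 / 2 := by positivity
  have hG := Real.Gamma_pos_of_pos (zero_lt_one.trans hcT)
  have hcT0 : 0 < c * T := zero_lt_one.trans hcT
  have hi1 := integral_gammaDensity hcT0 hm
  have hi2 := integral_gammaDensity hcT0 hp
  have hright : ∀ x, 0 < x → doubleGammaDensity c lam μ T x =
      mixB c lam μ T / (mixA c lam μ T + mixB c lam μ T) *
        ((lam / μ + 1 / 2) ^ (c * T) / Real.Gamma (c * T) * x ^ (c * T - 1) *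
          Real.exp (-(lam / μ + 1 / 2) * x)) := fun x hx => by
    simp [doubleGammaDensity, hx, hx.not_gt]
  have hleft : ∀ x, x < 0 → doubleGammaDensity c lam μ T x =
      mixA c lam μ T / (mixA c lam μ T + mixB c lam μ T) *
        ((lam / μ - 1 / 2) ^ (c * T) / Real.Gamma (c * T) * (-x) ^ (c * T - 1) *
          Real.exp ((lam / μ - 1 / 2) * x)) := fun x hx => by
    simp [doubleGammaDensity, hx, hx.not_gt]
  have hpos : ∀ x, x ≠ 0 → 0 < doubleGammaDensity c lam μ T x := by
    intro x hx
    rcases lt_or_gt_of_ne hx with h | h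
    · have : 0 < -x := neg_pos.2 h
      rw [hleft x h]; positivity
    · rw [hright x h]; positivity
  have hsymm : ∀ x, 0 < x → Real.exp (x / 2) * doubleGammaDensity c lam μ T x
      = Real.exp (-x / 2) * doubleGammaDensity c lam μ T (-x) := by
    intro x hx
    rw [hright x hx, hleft (-x) (neg_neg_of_pos hx), neg_neg]
    have e1 : Real.exp (x / 2) * Real.exp (-(lam / μ + 1 / 2) * x) = Real.exp (-(lam / μ) * x) := by
      rw [← Real.exp_add]; ring_nf
    have e2 : Real.exp (-x / 2) * Real.exp ((lam / μ - 1 / 2) * -x) = Real.exp (-(lam / μ) * x) := by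
      rw [← Real.exp_add]; ring_nf
    have e3 := mixA_mul_rpow (c := c) (T := T) hlam hμ hμlam
    calc _ = (mixB c lam μ T * (lam / μ + 1 / 2) ^ (c * T)) / (mixA c lam μ T + mixB c lam μ T)
            / Real.Gamma (c * T) * x ^ (c * T - 1)
            * (Real.exp (x / 2) * Real.exp (-(lam / μ + 1 / 2) * x)) := by ring
      _ = (mixA c lam μ T * (lam / μ - 1 / 2) ^ (c * T)) / (mixA c lam μ T + mixB c lam μ T)
            / Real.Gamma (c * T) * x ^ (c * T - 1)
            * (Real.exp (-x / 2) * Real.exp ((lam / μ - 1 / 2) * -x)) := by rw [e1, e2, e3]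
      _ = _ := by ring
  refine { continuous := ?_, nonneg := fun x => ?_, integral_eq_one := ?_, symm := fun x => ?_,
           pos := hpos, analytic := ?_, tail := ?_ }
  · rw [funext doubleGammaDensity_eq]
    have h1 := (continuous_gammaDensity hcT (lam / μ - 1 / 2)).comp continuous_neg
    exact (h1.const_mul _).add ((continuous_gammaDensity hcT _).const_mul _)
  · rcases eq_or_ne x 0 with rfl | hx
    · simp [doubleGammaDensity]
    · exact (hpos x hx).le
  · rw [funext doubleGammaDensity_eq, integral_add, integral_const_mul, integral_const_mul,
      integral_neg_eq_self (gammaDensity _ _), hi1, hi2]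
    · field_simp
    · exact (integrable_of_integral_eq_one hi1).comp_neg.const_mul _
    · exact (integrable_of_integral_eq_one hi2).const_mul _
  · rcases lt_trichotomy x 0 with hx | rfl | hx
    · have := hsymm (-x) (neg_pos.2 hx)
      rw [neg_neg] at this
      exact this.symm
    · simp
    · exact hsymm x hx
  · intro x hx
    have han : AnalyticAt ℝ (fun x : ℝ => mixB c lam μ T / (mixA c lam μ T + mixB c lam μ T) *
        ((lam / μ + 1 / 2) ^ (c * T) / Real.Gamma (c * T) * Real.exp (Real.log x * (c * T - 1)) *
          Real.exp (-(lam / μ + 1 / 2) * x))) x := by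
      have h1 : AnalyticAt ℝ (fun x : ℝ => Real.log x * (c * T - 1)) x :=
        (analyticAt_log hx).mul analyticAt_const
      have h2 : AnalyticAt ℝ (fun x : ℝ => -(lam / μ + 1 / 2) * x) x :=
        analyticAt_const.mul analyticAt_id
      exact analyticAt_const.mul ((analyticAt_const.mul h1.rexp').mul h2.rexp')
    refine han.congr ?_
    filter_upwards [lt_mem_nhds (show (0 : ℝ) < x from hx)] with y hy
    rw [hright y hy, Real.rpow_def_of_pos hy]
  · refine ⟨mixB c lam μ T / (mixA c lam μ T + mixB c lam μ T) *
        ((lam / μ + 1 / 2) ^ (c * T) / Real.Gamma (c * T)), lam / μ + 1 / 2, by positivity,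
      fun x hx => ?_⟩
    rw [hright x (by linarith), mul_assoc]
    gcongr
    exact le_mul_of_one_le_right (by positivity) (Real.one_le_rpow hx (by linarith))

end DoubleGamma

/-! ### Normal variance mixtures with gamma mixing -/

/-- The integral `∫_0^∞ u^{ν-1} e^{-Au} e^{-x²/(2u)} du`, which is up to elementary factors the
Bessel function `|x|^ν K_ν(√(2A) |x|)`, but is well behaved at `x = 0`. -/
def mixtureIntegral (ν A x : ℝ) : ℝ :=
  ∫ u in Ioi (0 : ℝ), u ^ (ν - 1) * Real.exp (-(A * u)) * Real.exp (-(x ^ 2 / (2 * u)))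

section MixtureIntegral

variable {ν A : ℝ}

lemma integrableOn_gammaWeight (hν : 0 < ν) (hA : 0 < A) :
    IntegrableOn (fun u : ℝ => u ^ (ν - 1) * Real.exp (-(A * u))) (Ioi 0) := by
  have h := integrableOn_rpow_mul_exp_neg_mul_rpow (s := ν - 1) (p := 1) (b := A) (by linarith)
    one_pos hA
  simpa [Real.rpow_one] using h

lemma measurable_mixtureIntegrand (ν A x : ℝ) : Measurable fun u : ℝ =>
    u ^ (ν - 1) * Real.exp (-(A * u)) * Real.exp (-(x ^ 2 / (2 * u))) := by
  fun_prop

lemma norm_mixtureIntegrand_le (ν A x : ℝ) {u : ℝ} (hu : 0 < u) :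
    ‖u ^ (ν - 1) * Real.exp (-(A * u)) * Real.exp (-(x ^ 2 / (2 * u)))‖
      ≤ u ^ (ν - 1) * Real.exp (-(A * u)) := by
  rw [Real.norm_of_nonneg (by positivity)]
  refine mul_le_of_le_one_right (by positivity) (Real.exp_le_one_iff.2 ?_)
  have : 0 ≤ x ^ 2 / (2 * u) := by positivity
  linarith

lemma integrableOn_mixtureIntegrand (hν : 0 < ν) (hA : 0 < A) (x : ℝ) : IntegrableOn (fun u : ℝ =>
    u ^ (ν - 1) * Real.exp (-(A * u)) * Real.exp (-(x ^ 2 / (2 * u)))) (Ioi 0) := by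
  refine Integrable.mono' (integrableOn_gammaWeight hν hA)
    (measurable_mixtureIntegrand ν A x).aestronglyMeasurable ?_
  exact (ae_restrict_iff' measurableSet_Ioi).2
    (Eventually.of_forall fun u hu => norm_mixtureIntegrand_le ν A x hu)

lemma mixtureIntegral_pos (hν : 0 < ν) (hA : 0 < A) (x : ℝ) : 0 < mixtureIntegral ν A x :=
  setIntegral_Ioi_pos (integrableOn_mixtureIntegrand hν hA x) fun u hu => by positivity

lemma mixtureIntegral_neg (ν A x : ℝ) : mixtureIntegral ν A (-x) = mixtureIntegral ν A x := by
  simp [mixtureIntegral]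

lemma mixtureIntegral_zero (hν : 0 < ν) (hA : 0 < A) :
    mixtureIntegral ν A 0 = (1 / A) ^ ν * Real.Gamma ν := by
  rw [← Real.integral_rpow_mul_exp_neg_mul_Ioi hν hA]
  simp [mixtureIntegral]

lemma continuous_mixtureIntegral (hν : 0 < ν) (hA : 0 < A) : Continuous (mixtureIntegral ν A) := by
  refine continuous_of_dominated (fun x => (measurable_mixtureIntegrand ν A x).aestronglyMeasurable)
    (fun x => ?_) (integrableOn_gammaWeight hν hA) (Eventually.of_forall fun u => by fun_prop)
  exact (ae_restrict_iff' measurableSet_Ioi).2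
    (Eventually.of_forall fun u hu => norm_mixtureIntegrand_le ν A x hu)

/-- The integral is the moment generating function of `-1/u` at `x²/2`, hence analytic. -/
lemma analyticOnNhd_mixtureIntegral (hν : 0 < ν) (hA : 0 < A) :
    AnalyticOnNhd ℝ (mixtureIntegral ν A) (Ioi 0) := by
  let ρ : Measure ℝ := (volume.restrict (Ioi 0)).withDensity
    fun u => ENNReal.ofReal (u ^ (ν - 1) * Real.exp (-(A * u)))
  have hmeas : Measurable fun u : ℝ => ENNReal.ofReal (u ^ (ν - 1) * Real.exp (-(A * u))) := by
    fun_prop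
  have hdens : ∀ u ∈ Ioi (0 : ℝ), 0 ≤ u ^ (ν - 1) * Real.exp (-(A * u)) := fun u hu => by
    have : (0 : ℝ) < u := hu
    positivity
  have hfin : IsFiniteMeasure ρ := isFiniteMeasure_withDensity_ofReal
    (integrableOn_gammaWeight hν hA).2
  have hmgf : ∀ x, mixtureIntegral ν A x = mgf (fun u => -(1 / u)) ρ (x ^ 2 / 2) := by
    intro x
    rw [mgf, integral_withDensity_eq_integral_toReal_smul hmeas
      (Eventually.of_forall fun _ => ENNReal.ofReal_lt_top), mixtureIntegral]
    refine setIntegral_congr_fun measurableSet_Ioi fun u hu => ?_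
    simp only [smul_eq_mul]
    rw [ENNReal.toReal_ofReal (hdens u hu)]
    congr 2
    ring
  have hexp : Ici (0 : ℝ) ⊆ integrableExpSet (fun u => -(1 / u)) ρ := by
    intro t ht
    have hac : ρ ≪ volume.restrict (Ioi 0) := withDensity_absolutelyContinuous _ _
    refine Integrable.mono' (integrable_const (1 : ℝ)) (by fun_prop) ?_
    filter_upwards [hac.ae_le (ae_restrict_mem measurableSet_Ioi)] with u hu
    have hu' : 0 < u := hu
    rw [Real.norm_of_nonneg (Real.exp_pos _).le, Real.exp_le_one_iff]
    have : 0 ≤ t * (1 / u) := mul_nonneg ht (by positivity)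
    linarith
  intro x hx
  have hx2 : x ^ 2 / 2 ∈ interior (integrableExpSet (fun u => -(1 / u)) ρ) := by
    refine interior_mono hexp ?_
    rw [interior_Ici]
    have : (0 : ℝ) < x := hx
    exact mem_Ioi.2 (by positivity)
  rw [funext hmgf]
  have h2 : AnalyticAt ℝ (fun x : ℝ => x ^ 2 / 2) x := by
    simp only [div_eq_mul_inv]
    fun_prop
  exact AnalyticAt.fun_comp (analyticAt_mgf hx2) h2

/-- An exponential lower bound: restrict the integral to `x ≤ u ≤ 2x`. -/
lemma le_mixtureIntegral (hν : 0 < ν) (hA : 0 < A) {x : ℝ} (hx : 1 ≤ x) :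
    1 / 2 * Real.exp (-(2 * A + 1 / 2) * x) ≤ mixtureIntegral ν A x := by
  have hx0 : 0 < x := by linarith
  have hi := integrableOn_mixtureIntegrand hν hA x
  have hsub : Ioc x (2 * x) ⊆ Ioi 0 := fun u hu => hx0.trans hu.1
  calc 1 / 2 * Real.exp (-(2 * A + 1 / 2) * x)
      = ∫ _ in Ioc x (2 * x), 1 / (2 * x) * Real.exp (-(2 * A + 1 / 2) * x) := by
        rw [setIntegral_const, measureReal_def, Real.volume_Ioc, ENNReal.toReal_ofReal (by linarith),
          smul_eq_mul]
        field_simp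
        ring
    _ ≤ ∫ u in Ioc x (2 * x),
          u ^ (ν - 1) * Real.exp (-(A * u)) * Real.exp (-(x ^ 2 / (2 * u))) := by
        refine setIntegral_mono_on (integrableOn_const (by simp)) (hi.mono_set hsub)
          measurableSet_Ioc fun u hu => ?_
        have hu0 : 0 < u := hx0.trans hu.1
        have h1 : 1 / (2 * x) ≤ u ^ (ν - 1) := by
          calc 1 / (2 * x) ≤ 1 / u := one_div_le_one_div_of_le hu0 hu.2
            _ = u ^ (-1 : ℝ) := by rw [Real.rpow_neg_one, one_div]
            _ ≤ u ^ (ν - 1) := Real.rpow_le_rpow_of_exponent_le (hx.trans hu.1.le) (by linarith)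
        have h2 : x ^ 2 / (2 * u) ≤ x / 2 := by
          rw [div_le_div_iff₀ (by positivity) two_pos]
          nlinarith [hu.1]
        have h3 : A * u ≤ A * (2 * x) := mul_le_mul_of_nonneg_left hu.2 hA.le
        rw [mul_assoc, ← Real.exp_add]
        exact mul_le_mul h1 (Real.exp_le_exp.2 (by linarith)) (Real.exp_pos _).le (by positivity)
    _ ≤ mixtureIntegral ν A x := by
        refine setIntegral_mono_set hi ?_ hsub.eventuallyLE
        refine (ae_restrict_iff' measurableSet_Ioi).2 (Eventually.of_forall fun u hu => ?_)
        have : (0 : ℝ) < u := hu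
        simp only [Pi.zero_apply]
        positivity

lemma exp_quadratic (β : ℝ) {u : ℝ} (hu : 0 < u) (x : ℝ) :
    Real.exp (β * x) * Real.exp (-(x ^ 2 / (2 * u)))
      = Real.exp (β ^ 2 / 2 * u) * Real.exp (-(1 / (2 * u)) * (x - β * u) ^ 2) := by
  rw [← Real.exp_add, ← Real.exp_add]
  congr 1
  field_simp
  ring

lemma integral_exp_quadratic (β : ℝ) {u : ℝ} (hu : 0 < u) :
    ∫ x, Real.exp (β * x) * Real.exp (-(x ^ 2 / (2 * u)))
      = √(2 * Real.pi) * u ^ (1 / 2 : ℝ) * Real.exp (β ^ 2 / 2 * u) := by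
  simp only [exp_quadratic β hu]
  rw [integral_const_mul,
    integral_sub_right_eq_self (fun x => Real.exp (-(1 / (2 * u)) * x ^ 2)) (β * u),
    integral_gaussian, ← Real.sqrt_eq_rpow, ← Real.sqrt_mul (by positivity), mul_comm]
  congr 2
  field_simp

lemma integrable_exp_quadratic (β : ℝ) {u : ℝ} (hu : 0 < u) :
    Integrable fun x => Real.exp (β * x) * Real.exp (-(x ^ 2 / (2 * u))) := by
  simp only [exp_quadratic β hu]
  exact ((integrable_exp_neg_mul_sq (by positivity : 0 < 1 / (2 * u))).comp_sub_right
    (β * u)).const_mul _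

/-- The Laplace transform of the mixture integral, by Fubini and the Gaussian integral. -/
lemma integral_exp_mul_mixtureIntegral (hν : 0 < ν) {β : ℝ} (hβ : β ^ 2 / 2 < A) :
    ∫ x, Real.exp (β * x) * mixtureIntegral ν A x
      = √(2 * Real.pi) * ((1 / (A - β ^ 2 / 2)) ^ (ν + 1 / 2) * Real.Gamma (ν + 1 / 2)) := by
  have hr : 0 < A - β ^ 2 / 2 := sub_pos.2 hβ
  let F : ℝ → ℝ → ℝ := fun x u => u ^ (ν - 1) * Real.exp (-(A * u)) *
    (Real.exp (β * x) * Real.exp (-(x ^ 2 / (2 * u))))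
  have hinner : ∀ u, 0 < u → ∫ x, F x u
      = √(2 * Real.pi) * (u ^ (ν + 1 / 2 - 1) * Real.exp (-((A - β ^ 2 / 2) * u))) := by
    intro u hu
    simp only [F]
    rw [integral_const_mul, integral_exp_quadratic β hu,
      show ν + 1 / 2 - 1 = (ν - 1) + 1 / 2 by ring, Real.rpow_add hu,
      show -((A - β ^ 2 / 2) * u) = -(A * u) + β ^ 2 / 2 * u by ring, Real.exp_add]
    ring
  have hmeas : Measurable (Function.uncurry F) := by
    simp only [Function.uncurry_def, F]
    fun_prop
  have hint : Integrable (Function.uncurry F) (volume.prod (volume.restrict (Ioi 0))) := by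
    rw [integrable_prod_iff' hmeas.aestronglyMeasurable]
    constructor
    · refine (ae_restrict_iff' measurableSet_Ioi).2 (Eventually.of_forall fun u hu => ?_)
      simp only [Function.uncurry_apply_pair, F]
      exact (integrable_exp_quadratic β hu).const_mul _
    · refine IntegrableOn.congr_fun ((integrableOn_gammaWeight (ν := ν + 1 / 2)
        (by linarith) hr).const_mul (√(2 * Real.pi))) (fun u hu => ?_) measurableSet_Ioi
      have hu' : (0 : ℝ) < u := hu
      simp only [Function.uncurry_apply_pair]
      rw [← hinner u hu]
      refine integral_congr_ae (Eventually.of_forall fun x => ?_)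
      simp only
      rw [Real.norm_of_nonneg]
      simp only [F]
      positivity
  calc ∫ x, Real.exp (β * x) * mixtureIntegral ν A x
      = ∫ x, ∫ u in Ioi 0, F x u := by
        refine integral_congr_ae (Eventually.of_forall fun x => ?_)
        simp only [mixtureIntegral, F]
        rw [← integral_const_mul]
        refine integral_congr_ae (Eventually.of_forall fun u => ?_)
        simp only
        ring
    _ = ∫ u in Ioi 0, ∫ x, F x u := integral_integral_swap hint
    _ = ∫ u in Ioi 0,
          √(2 * Real.pi) * (u ^ (ν + 1 / 2 - 1) * Real.exp (-((A - β ^ 2 / 2) * u))) :=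
        setIntegral_congr_fun measurableSet_Ioi fun u hu => hinner u hu
    _ = _ := by
        rw [integral_const_mul, Real.integral_rpow_mul_exp_neg_mul_Ioi (by linarith) hr]

/-- The substitution `t = (α / |x|) u` turns the Bessel integral into the mixture integral. -/
lemma abs_rpow_mul_besselK (ν : ℝ) {α x : ℝ} (hα : 0 < α) (hx : x ≠ 0) :
    |x / α| ^ ν * besselK ν (α * |x|) = 1 / 2 * mixtureIntegral ν (α ^ 2 / 2) x := by
  have hx' : 0 < |x| := abs_pos.2 hx
  have hb : 0 < α / |x| := div_pos hα hx'
  have hsub := integral_comp_mul_left_Ioi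
    (fun t : ℝ => t ^ (ν - 1) * Real.exp (-(α * |x| / 2) * (t + 1 / t))) 0 hb
  rw [mul_zero, smul_eq_mul, eq_inv_mul_iff_mul_eq₀ hb.ne'] at hsub
  rw [besselK, ← hsub, mixtureIntegral, mul_left_comm, ← integral_const_mul, ← integral_const_mul]
  congr 1
  refine setIntegral_congr_fun measurableSet_Ioi fun u hu => ?_
  have hu' : (0 : ℝ) < u := hu
  have h1 : |x / α| ^ ν * (α / |x| * (α / |x|) ^ (ν - 1)) = 1 := by
    rw [Real.rpow_sub_one hb.ne', mul_div_cancel₀ _ hb.ne', abs_div, abs_of_pos hα,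
      ← Real.mul_rpow (by positivity) hb.le, div_mul_div_cancel₀ hα.ne', div_self hx'.ne',
      Real.one_rpow]
  have h2 : -(α * |x| / 2) * (α / |x| * u + 1 / (α / |x| * u))
      = -(α ^ 2 / 2 * u) + -(x ^ 2 / (2 * u)) := by
    rw [← sq_abs x]
    field_simp
    ring
  rw [h2, Real.exp_add, Real.mul_rpow hb.le hu'.le]
  linear_combination u ^ (ν - 1) * Real.exp (-(α ^ 2 / 2 * u)) * Real.exp (-(x ^ 2 / (2 * u))) * h1

end MixtureIntegral

/-! ### The variance-gamma mixture density -/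

section VarianceGamma

variable {c lam μ T v ε : ℝ}

lemma vgAlpha_sq (hlam : 0 < lam) :
    vgAlpha lam μ v ^ 2 = μ ^ 2 / v ^ 4 + 2 * lam / v ^ 2 + 1 / 4 :=
  Real.sq_sqrt (by positivity)

lemma vgAlpha_pos (hlam : 0 < lam) : 0 < vgAlpha lam μ v :=
  Real.sqrt_pos.2 (by positivity)

lemma vgAlpha_sq_sub_vgBeta_sq (hlam : 0 < lam) (hv : 0 < v) (hε : ε ^ 2 = 1) :
    vgAlpha lam μ v ^ 2 / 2 - vgBeta μ v ε ^ 2 / 2 = (lam + ε * (μ / 2)) / v ^ 2 := by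
  rw [vgAlpha_sq hlam, vgBeta]
  field_simp
  linear_combination (-16 * μ ^ 2) * hε

lemma vgDensity_eq (hlam : 0 < lam) (hcT : 1 < c * T) (x : ℝ) :
    vgDensity c lam μ T v ε x = vgGamma c lam μ T v ε / 2 * Real.exp (vgBeta μ v ε * x)
      * mixtureIntegral (c * T - 1 / 2) (vgAlpha lam μ v ^ 2 / 2) x := by
  have hα := vgAlpha_pos (μ := μ) (v := v) hlam
  have hν : 0 < c * T - 1 / 2 := by linarith
  rw [vgDensity]
  split_ifs with hx
  · subst hx
    rw [mixtureIntegral_zero hν (by positivity), one_div_div, Real.div_rpow two_pos.le (by positivity),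
      ← Real.rpow_natCast (vgAlpha lam μ v) 2, ← Real.rpow_mul hα.le, Real.rpow_neg hα.le,
      Real.rpow_sub_one two_ne_zero, mul_zero, Real.exp_zero, Nat.cast_ofNat]
    ring
  · rw [mul_right_comm (vgGamma c lam μ T v ε), mul_assoc _ (_ ^ _), abs_rpow_mul_besselK _ hα hx]
    ring

lemma vgGamma_pos (hcT : 1 < c * T) (hv : 0 < v) (hpos : 0 < lam + ε * (μ / 2)) :
    0 < vgGamma c lam μ T v ε := by
  have hG := Real.Gamma_pos_of_pos (zero_lt_one.trans hcT)
  have := Real.pi_pos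
  unfold vgGamma
  positivity

lemma integral_vgDensity (hlam : 0 < lam) (hcT : 1 < c * T) (hv : 0 < v) (hε : ε ^ 2 = 1)
    (hpos : 0 < lam + ε * (μ / 2)) : ∫ x, vgDensity c lam μ T v ε x = 1 := by
  have hG := Real.Gamma_pos_of_pos (zero_lt_one.trans hcT)
  have hpi := Real.pi_pos
  have hsub := vgAlpha_sq_sub_vgBeta_sq (μ := μ) hlam hv hε
  have hr : 0 < (lam + ε * (μ / 2)) / v ^ 2 := by positivity
  simp only [vgDensity_eq hlam hcT, mul_assoc]
  rw [integral_const_mul, integral_exp_mul_mixtureIntegral (by linarith)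
    (sub_pos.1 (hsub.symm ▸ hr)), hsub, sub_add_cancel, vgGamma, one_div ((lam + ε * (μ / 2)) / v ^ 2),
    Real.inv_rpow hr.le]
  have h2 : √(2 / Real.pi) * √(2 * Real.pi) = 2 := by
    rw [← Real.sqrt_mul (by positivity), show 2 / Real.pi * (2 * Real.pi) = 2 ^ 2 by field_simp]
    exact Real.sqrt_sq two_pos.le
  have hr' := Real.rpow_pos_of_pos hr (c * T)
  generalize ((lam + ε * (μ / 2)) / v ^ 2) ^ (c * T) = R at hr' ⊢
  field_simp
  linear_combination h2

lemma vgDensity_pos (hlam : 0 < lam) (hcT : 1 < c * T) (hv : 0 < v)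
    (hpos : 0 < lam + ε * (μ / 2)) (x : ℝ) : 0 < vgDensity c lam μ T v ε x := by
  have hα := vgAlpha_pos (μ := μ) (v := v) hlam
  have hγ := vgGamma_pos (c := c) (T := T) hcT hv hpos
  have hJ := mixtureIntegral_pos (ν := c * T - 1 / 2) (A := vgAlpha lam μ v ^ 2 / 2) (by linarith)
    (by positivity) x
  rw [vgDensity_eq hlam hcT]
  positivity

lemma mixA_mul_vgGamma (hlam : 0 < lam) (hμ : 0 < μ) (hμlam : μ < 2 * lam) (hv : 0 < v) :
    mixA c lam μ T * vgGamma c lam μ T v (-1) = mixB c lam μ T * vgGamma c lam μ T v 1 := by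
  have h1 : 0 < 1 - μ / (2 * lam) := by rw [sub_pos, div_lt_one (by positivity)]; exact hμlam
  have h2 : 0 ≤ (lam + -1 * (μ / 2)) / v ^ 2 := div_nonneg (by linarith) (by positivity)
  rw [vgGamma, vgGamma, mixA, mixB, mul_left_comm, mul_left_comm ((1 - _) ^ _),
    ← Real.mul_rpow (by positivity) h2, ← Real.mul_rpow h1.le (by positivity)]
  congr 2
  field_simp
  ring

/-- The common weight of the two exponentials in `mixDensity_eq`. -/
def mixWeight (c lam μ T v : ℝ) : ℝ :=
  mixB c lam μ T / (mixA c lam μ T + mixB c lam μ T) * (vgGamma c lam μ T v 1 / 2)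

/-- Both variance-gamma components share the even factor `mixtureIntegral`, and the mixing weights
are such that the exponential factors enter symmetrically. -/
lemma mixDensity_eq (hlam : 0 < lam) (hμ : 0 < μ) (hμlam : μ < 2 * lam) (hcT : 1 < c * T)
    (hv : 0 < v) (x : ℝ) : mixDensity c lam μ T v x = mixWeight c lam μ T v *
      (Real.exp (vgBeta μ v (-1) * x) + Real.exp (vgBeta μ v 1 * x))
      * mixtureIntegral (c * T - 1 / 2) (vgAlpha lam μ v ^ 2 / 2) x := by
  have h := mixA_mul_vgGamma (c := c) (T := T) hlam hμ hμlam hv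
  rw [mixDensity, if_neg hv.ne', vgDensity_eq hlam hcT, vgDensity_eq hlam hcT, mixWeight]
  linear_combination (1 / (mixA c lam μ T + mixB c lam μ T) / 2 * Real.exp (vgBeta μ v (-1) * x)
    * mixtureIntegral (c * T - 1 / 2) (vgAlpha lam μ v ^ 2 / 2) x) * h

lemma mixWeight_pos (hlam : 0 < lam) (hμ : 0 < μ) (hμlam : μ < 2 * lam) (hcT : 1 < c * T)
    (hv : 0 < v) : 0 < mixWeight c lam μ T v := by
  have hA := mixA_pos (c := c) (T := T) hlam hμ
  have hB := mixB_pos (c := c) (T := T) hlam hμlam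
  have hγ := vgGamma_pos (c := c) (T := T) (lam := lam) (μ := μ) (ε := 1) hcT hv (by linarith)
  unfold mixWeight
  positivity

theorem isSmileDensity_mixDensity_of_pos (hlam : 0 < lam) (hμ : 0 < μ) (hμlam : μ < 2 * lam)
    (hcT : 1 < c * T) (hv : 0 < v) : IsSmileDensity (mixDensity c lam μ T v) := by
  have hA := mixA_pos (c := c) (T := T) hlam hμ
  have hB := mixB_pos (c := c) (T := T) hlam hμlam
  have hα := vgAlpha_pos (μ := μ) (v := v) hlam
  have hW := mixWeight_pos hlam hμ hμlam hcT hv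
  have hν : 0 < c * T - 1 / 2 := by linarith
  have hα2 : 0 < vgAlpha lam μ v ^ 2 / 2 := by positivity
  have heq := mixDensity_eq hlam hμ hμlam hcT hv
  have hpos : ∀ x, 0 < mixDensity c lam μ T v x := fun x => by
    have := mixtureIntegral_pos hν hα2 x
    rw [heq]; positivity
  refine { continuous := ?_, nonneg := fun x => (hpos x).le, integral_eq_one := ?_,
           symm := fun x => ?_, pos := fun x _ => hpos x, analytic := ?_, tail := ?_ }
  · rw [funext heq]
    have := continuous_mixtureIntegral hν hα2
    fun_prop
  · have h1 := integral_vgDensity (c := c) (T := T) (lam := lam) (μ := μ) (ε := -1) hlam hcT hv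
      (by norm_num) (by linarith)
    have h2 := integral_vgDensity (c := c) (T := T) (lam := lam) (μ := μ) (ε := 1) hlam hcT hv
      (by norm_num) (by linarith)
    simp only [mixDensity, if_neg hv.ne']
    rw [integral_add ((integrable_of_integral_eq_one h1).const_mul _)
      ((integrable_of_integral_eq_one h2).const_mul _), integral_const_mul, integral_const_mul, h1, h2]
    field_simp
  · have e : ∀ ε : ℝ, Real.exp (x / 2) * Real.exp (vgBeta μ v ε * x)
        = Real.exp (-x / 2) * Real.exp (vgBeta μ v (-ε) * -x) := fun ε => by
      rw [← Real.exp_add, ← Real.exp_add, vgBeta, vgBeta]; ring_nf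
    have e1 := e 1
    have e2 := e (-1)
    rw [neg_neg] at e2
    rw [heq, heq, mixtureIntegral_neg]
    linear_combination (mixWeight c lam μ T v
      * mixtureIntegral (c * T - 1 / 2) (vgAlpha lam μ v ^ 2 / 2) x) * (e1 + e2)
  · rw [funext heq]
    have he : ∀ ε, AnalyticOnNhd ℝ (fun x => Real.exp (vgBeta μ v ε * x)) (Ioi 0) := fun ε x _ =>
      (analyticAt_const.mul analyticAt_id).rexp'
    exact (analyticOnNhd_const.mul ((he _).add (he _))).mul (analyticOnNhd_mixtureIntegral hν hα2)
  · refine ⟨mixWeight c lam μ T v * (1 / 2),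
      (2 * (vgAlpha lam μ v ^ 2 / 2) + 1 / 2) - vgBeta μ v 1, by positivity, fun x hx => ?_⟩
    rw [heq]
    calc _ = mixWeight c lam μ T v * Real.exp (vgBeta μ v 1 * x)
          * (1 / 2 * Real.exp (-(2 * (vgAlpha lam μ v ^ 2 / 2) + 1 / 2) * x)) := by
          rw [show -(2 * (vgAlpha lam μ v ^ 2 / 2) + 1 / 2 - vgBeta μ v 1) * x
            = vgBeta μ v 1 * x + -(2 * (vgAlpha lam μ v ^ 2 / 2) + 1 / 2) * x by ring, Real.exp_add]
          ring
      _ ≤ _ := by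
          gcongr
          · exact le_add_of_nonneg_left (Real.exp_pos _).le
          · exact le_mixtureIntegral hν hα2 hx

theorem isSmileDensity_mixDensity (hlam : 0 < lam) (hμ : 0 < μ) (hμlam : μ < 2 * lam)
    (hcT : 1 < c * T) (hv : 0 ≤ v) : IsSmileDensity (mixDensity c lam μ T v) := by
  rcases hv.eq_or_lt with rfl | hv
  · have : mixDensity c lam μ T 0 = doubleGammaDensity c lam μ T := by
      funext x; simp [mixDensity]
    rw [this]
    exact isSmileDensity_doubleGammaDensity hlam hμ hμlam hcT
  · exact isSmileDensity_mixDensity_of_pos hlam hμ hμlam hcT hv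

/-! ### The dip at zero for small `v` -/

/-- As soon as `β₊ ≥ 0`, the component `f₊` puts at least half of its mass on `(0, ∞)`. This bounds
the at-the-money implied volatility uniformly in `v`. -/
lemma le_survival_mixDensity (hlam : 0 < lam) (hμ : 0 < μ) (hμlam : μ < 2 * lam) (hcT : 1 < c * T)
    (hv : 0 < v) (hβ : 0 ≤ vgBeta μ v 1) :
    mixB c lam μ T / (mixA c lam μ T + mixB c lam μ T) / 2
      ≤ survival (mixDensity c lam μ T v) 0 := by
  have hA := mixA_pos (c := c) (T := T) hlam hμ
  have hB := mixB_pos (c := c) (T := T) hlam hμlam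
  have hp1 : 0 < lam + 1 * (μ / 2) := by linarith
  have hp2 : 0 < lam + -1 * (μ / 2) := by linarith
  have h1 := integral_vgDensity (c := c) (T := T) hlam hcT hv (by norm_num) hp1
  have hi := integrable_of_integral_eq_one h1
  have hhalf : 1 / 2 ≤ ∫ x in Ioi (0 : ℝ), vgDensity c lam μ T v 1 x := by
    have hsplit := integral_add_compl (measurableSet_Iic (a := (0 : ℝ))) hi
    rw [compl_Iic, h1] at hsplit
    have hneg := integral_comp_neg_Ioi 0 (vgDensity c lam μ T v 1)
    rw [neg_zero] at hneg
    have hle : ∫ x in Ioi (0 : ℝ), vgDensity c lam μ T v 1 (-x)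
        ≤ ∫ x in Ioi (0 : ℝ), vgDensity c lam μ T v 1 x := by
      refine setIntegral_mono_on hi.comp_neg.integrableOn hi.integrableOn measurableSet_Ioi
        fun x hx => ?_
      have hx' : (0 : ℝ) < x := hx
      have hγ := vgGamma_pos (c := c) (T := T) hcT hv hp1
      have hα := vgAlpha_pos (μ := μ) (v := v) hlam
      have hJ := mixtureIntegral_pos (ν := c * T - 1 / 2) (A := vgAlpha lam μ v ^ 2 / 2)
        (by linarith) (by positivity) x
      rw [vgDensity_eq hlam hcT, vgDensity_eq hlam hcT, mixtureIntegral_neg]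
      gcongr
      linarith
    linarith
  have hint := (isSmileDensity_mixDensity_of_pos hlam hμ hμlam hcT hv).integrable
  calc _ = mixB c lam μ T / (mixA c lam μ T + mixB c lam μ T) * (1 / 2) := by ring
    _ ≤ mixB c lam μ T / (mixA c lam μ T + mixB c lam μ T)
          * ∫ x in Ioi (0 : ℝ), vgDensity c lam μ T v 1 x := by gcongr
    _ = ∫ x in Ioi (0 : ℝ), mixB c lam μ T / (mixA c lam μ T + mixB c lam μ T)
          * vgDensity c lam μ T v 1 x := (integral_const_mul _ _).symm
    _ ≤ survival (mixDensity c lam μ T v) 0 := by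
        refine setIntegral_mono_on (hi.const_mul _).integrableOn hint.integrableOn
          measurableSet_Ioi fun x _ => ?_
        rw [mixDensity, if_neg hv.ne']
        have := vgDensity_pos (c := c) (T := T) hlam hcT hv hp2 x
        exact le_add_of_nonneg_left (by positivity)

/-- The value at `0` vanishes as `v ↓ 0`; this is where `cT > 1` enters. -/
lemma exists_mixDensity_zero_le (hlam : 0 < lam) (hμ : 0 < μ) (hμlam : μ < 2 * lam)
    (hcT : 1 < c * T) :
    ∃ C, ∀ v, 0 < v → mixDensity c lam μ T v 0 ≤ C * (v ^ 2) ^ (c * T - 1) := by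
  have hA := mixA_pos (c := c) (T := T) hlam hμ
  have hB := mixB_pos (c := c) (T := T) hlam hμlam
  have hν : 0 < c * T - 1 / 2 := by linarith
  have hGν := Real.Gamma_pos_of_pos hν
  refine ⟨mixB c lam μ T / (mixA c lam μ T + mixB c lam μ T) * (√(2 / Real.pi)
      * (1 / Real.Gamma (c * T)) * (lam + 1 * (μ / 2)) ^ (c * T))
      * ((2 / μ ^ 2) ^ (c * T - 1 / 2) * Real.Gamma (c * T - 1 / 2)), fun v hv => ?_⟩
  have hW := mixWeight_pos hlam hμ hμlam hcT hv
  have hα := vgAlpha_pos (μ := μ) (v := v) hlam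
  have hs : 0 < v ^ 2 := by positivity
  have hle : (1 / (vgAlpha lam μ v ^ 2 / 2)) ^ (c * T - 1 / 2)
      ≤ (2 / μ ^ 2) ^ (c * T - 1 / 2) * (v ^ 2) ^ (2 * (c * T - 1 / 2)) := by
    rw [Real.rpow_mul hs.le, ← Real.mul_rpow (by positivity) (by positivity)]
    refine Real.rpow_le_rpow (by positivity) ?_ hν.le
    have h4 : μ ^ 2 / v ^ 4 ≤ vgAlpha lam μ v ^ 2 := by
      rw [vgAlpha_sq hlam]
      have : 0 ≤ 2 * lam / v ^ 2 := by positivity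
      linarith
    calc 1 / (vgAlpha lam μ v ^ 2 / 2) ≤ 1 / (μ ^ 2 / v ^ 4 / 2) := by gcongr
      _ = 2 / μ ^ 2 * (v ^ 2) ^ (2 : ℝ) := by
        rw [Real.rpow_two]; field_simp
  have hexp : (v ^ 2) ^ (2 * (c * T - 1 / 2)) = (v ^ 2) ^ (c * T) * (v ^ 2) ^ (c * T - 1) := by
    rw [← Real.rpow_add hs]; ring_nf
  have hcTpos := Real.rpow_pos_of_pos hs (c * T)
  rw [mixDensity_eq hlam hμ hμlam hcT hv, mixtureIntegral_zero hν (by positivity)]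
  simp only [mul_zero, Real.exp_zero]
  calc _ ≤ mixWeight c lam μ T v * (1 + 1) * ((2 / μ ^ 2) ^ (c * T - 1 / 2)
          * (v ^ 2) ^ (2 * (c * T - 1 / 2)) * Real.Gamma (c * T - 1 / 2)) := by gcongr
    _ = _ := by
        rw [hexp, mixWeight, vgGamma, Real.div_rpow (by positivity) hs.le]
        field_simp
        ring

lemma exists_forall_mixDensity_zero_lt (hlam : 0 < lam) (hμ : 0 < μ) (hμlam : μ < 2 * lam)
    (hcT : 1 < c * T) {m : ℝ} (hm : 0 < m) :
    ∃ δ, 0 < δ ∧ ∀ v, 0 < v → v < δ → mixDensity c lam μ T v 0 < m := by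
  obtain ⟨C, hC⟩ := exists_mixDensity_zero_le (c := c) (T := T) hlam hμ hμlam hcT
  have hcont : Continuous fun v : ℝ => C * (v ^ 2) ^ (c * T - 1) :=
    continuous_const.mul ((continuous_pow 2).rpow_const fun _ => Or.inr (by linarith))
  have h0 : C * ((0 : ℝ) ^ 2) ^ (c * T - 1) < m := by
    rw [zero_pow two_ne_zero, Real.zero_rpow (by linarith), mul_zero]; exact hm
  obtain ⟨δ, hδ, h⟩ := Metric.eventually_nhds_iff.1 (hcont.continuousAt.eventually_lt_const h0)
  refine ⟨δ, hδ, fun v hv hvδ => (hC v hv).trans_lt (h ?_)⟩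
  rwa [Real.dist_eq, sub_zero, abs_of_pos hv]

lemma mixDensity_zero_zero : mixDensity c lam μ T 0 0 = 0 := by
  simp [mixDensity, doubleGammaDensity]

/-- For small `v` the density lies at `0` below the normal density belonging to the at-the-money
total volatility `w`, and also below the one belonging to `w / √T`. -/
theorem exists_forall_dip (hlam : 0 < lam) (hμ : 0 < μ) (hT : 0 < T) (hμlam : μ < 2 * lam)
    (hcT : 1 < c * T) :
    ∃ vstar, 0 < vstar ∧ ∀ v, 0 ≤ v → v < vstar → ∀ w, 0 < w →
      symmCall (survival (mixDensity c lam μ T v)) 0 = bsPrice 0 w →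
        DipAtZero (mixDensity c lam μ T v) w ∧ DipAtZero (mixDensity c lam μ T v) (w / √T) := by
  have hsT : 0 < √T := Real.sqrt_pos.2 hT
  have hA := mixA_pos (c := c) (T := T) hlam hμ
  have hB := mixB_pos (c := c) (T := T) hlam hμlam
  set q := mixB c lam μ T / (mixA c lam μ T + mixB c lam μ T) / 2 with hq
  have hq0 : 0 < q := by positivity
  -- an upper bound `W` for the at-the-money total volatility which does not depend on `v`
  obtain ⟨W, hWq, hW⟩ : ∃ W, stdNormalCDF (-W / 2) < q ∧ 0 < W := by
    have h1 : Tendsto (fun W : ℝ => -W / 2) atTop atBot :=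
      tendsto_neg_atTop_atBot.atBot_div_const two_pos
    exact (((tendsto_stdNormalCDF_atBot.comp h1).eventually (gt_mem_nhds hq0)).and
      (eventually_gt_atTop 0)).exists
  obtain ⟨δ, hδ, hδm⟩ := exists_forall_mixDensity_zero_lt (c := c) (T := T) hlam hμ hμlam hcT
    (lt_min (bsDensity_zero_pos hW) (bsDensity_zero_pos (div_pos hW hsT)))
  -- the second bound on `v` ensures `β₊ ≥ 0`
  refine ⟨min δ √(2 * μ), lt_min hδ (by positivity), fun v hv hvlt w hw hATM => ?_⟩
  rcases hv.eq_or_lt with rfl | hv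
  · rw [DipAtZero, DipAtZero, mixDensity_zero_zero]
    exact ⟨bsDensity_zero_pos hw, bsDensity_zero_pos (div_pos hw hsT)⟩
  · have hβ : 0 ≤ vgBeta μ v 1 := by
      have h2 : v ^ 2 < 2 * μ := (Real.lt_sqrt hv.le).1 (hvlt.trans_le (min_le_right _ _))
      rw [vgBeta, sub_nonneg, one_mul, div_le_div_iff₀ two_pos (by positivity)]
      linarith
    have hsurv := le_survival_mixDensity (c := c) (T := T) hlam hμ hμlam hcT hv hβ
    rw [bsPrice, symmCall_zero, symmCall_zero, bsSurvival, neg_zero, zero_div, zero_sub] at hATM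
    have hwW : w < W := by
      have h3 : stdNormalCDF (-W / 2) < stdNormalCDF (-(w / 2)) := by linarith
      linarith [strictMono_stdNormalCDF.lt_iff_lt.1 h3]
    have hv0 := hδm v hv (hvlt.trans_le (min_le_left _ _))
    exact ⟨(hv0.trans_le (min_le_left _ _)).trans_le (bsDensity_zero_antitone hw hwW.le),
      (hv0.trans_le (min_le_right _ _)).trans_le (bsDensity_zero_antitone (div_pos hw hsT)
        (div_le_div_of_nonneg_right hwW.le hsT.le))⟩

end VarianceGamma

end

end WSmile

/-! ### The smile of the variance-gamma mixture model -/

theorem mainTheorem3 (c lam μ T : ℝ) (hc : 0 < c) (hlam : 0 < lam) (hμ : 0 < μ) (hT : 0 < T)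
    (hμlam : μ < 2 * lam) (hcT : 1 < c * T) :
    ∃ vstar : ℝ, 0 < vstar ∧ ∀ v : ℝ, 0 ≤ v → v < vstar →
      WSmile.IsRiskNeutralDensity (WSmile.mixDensity c lam μ T v) ∧
      WSmile.GeometricSymmetry (WSmile.mixDensity c lam μ T v) ∧
      WSmile.SemiHeavyTails (WSmile.mixDensity c lam μ T v) ∧
      ∀ S₀ : ℝ, 0 < S₀ →
        ∃ σ : ℝ → ℝ, WSmile.IsImpliedVolatility (WSmile.mixDensity c lam μ T v) S₀ T σ ∧
          WSmile.DipAtZero (WSmile.mixDensity c lam μ T v) (σ S₀ * √T) ∧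
          WSmile.DipAtZero (WSmile.mixDensity c lam μ T v) (σ S₀) ∧
          WSmile.IsWPlusShaped σ := by
  have hsT : 0 < √T := Real.sqrt_pos.2 hT
  obtain ⟨vstar, hvstar, hdip⟩ := WSmile.exists_forall_dip hlam hμ hT hμlam hcT
  refine ⟨vstar, hvstar, fun v hv hvlt => ?_⟩
  have hf := WSmile.isSmileDensity_mixDensity hlam hμ hμlam hcT hv
  refine ⟨hf.isRiskNeutralDensity, hf.symm, hf.semiHeavyTails, fun S₀ hS => ?_⟩
  obtain ⟨σ, hσ, hσ'⟩ := hf.exists_impliedVolatility hS hT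
  have hATM := hσ' S₀ hS
  rw [div_self hS.ne', Real.log_one] at hATM
  obtain ⟨hdip₁, hdip₂⟩ := hdip v hv hvlt _ (mul_pos (hσ S₀ hS).1 hsT) hATM
  rw [mul_div_cancel_right₀ _ hsT.ne'] at hdip₂
  exact ⟨σ, hσ, hdip₁, hdip₂, hf.isWPlusShaped hS hT (fun K hK => (hσ K hK).1) hσ' hdip₁⟩
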